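/- Let $\alpha: C\to C_0$ be a finite morphism of smooth projective connected algebraic curves over $\mathbb{C}$ which is a locally cyclic covering of degree $r$: it has degree $r$, and there are points $p\in C_0$ and $q\in C$ such that $\alpha^*(p)=r\cdot q$ as divisors. Then the pull-back homomorphism $\alpha^*:\mathrm{Jac}(C_0)\to\mathrm{Jac}(C)$ of the Jacobians, $[D]\mapsto[\alpha^*D]$, is injective. Moreover, the Prym variety $\mathrm{Prym}(\alpha)$, which is the whole kernel of the norm homomorphism $N_\alpha:\mathrm{Jac}(C)\to\mathrm{Jac}(C_0)$, $\left[\sum_q n_q\cdot q\right]\mapsto\left[\sum_q n_q\cdot\alpha(q)\right]$, is connected. -/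

import Mathlib

open CategoryTheory AlgebraicGeometry

noncomputable section

/-- A smooth projective (equivalently: smooth and proper) connected algebraic curve over `ℂ`. -/
structure SmoothCurve where
  /-- the underlying scheme -/
  X : Scheme.{0}
  /-- the structure morphism -/
  str : X ⟶ Spec (.of ℂ)
  integral : IsIntegral X
  proper : IsProper str
  smooth : SmoothOfRelativeDimension 1 str

namespace SmoothCurve

instance (C : SmoothCurve) : IsIntegral C.X := C.integral

instance (C : SmoothCurve) : IsProper C.str := C.proper

instance (C : SmoothCurve) : SmoothOfRelativeDimension 1 C.str := C.smooth

instance (C : SmoothCurve) : IsLocallyNoetherian C.X :=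
  LocallyOfFiniteType.isLocallyNoetherian C.str

end SmoothCurve

/-- The set `T(ℂ)` of complex points of a scheme `T` over `ℂ`. -/
def ComplexPoint {T : Scheme.{0}} (s : T ⟶ Spec (.of ℂ)) : Type :=
  {x : Spec (.of ℂ) ⟶ T // x ≫ s = 𝟙 _}

namespace ComplexPoint

variable {T U : Scheme.{0}} {s : T ⟶ Spec (.of ℂ)} {u : U ⟶ Spec (.of ℂ)}

/-- The (closed) point of the underlying space of `T` at which a complex point is supported. -/
def pt (x : ComplexPoint s) : T := x.1 (IsLocalRing.closedPoint ℂ)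

/-- The image of a complex point under a morphism over `ℂ`. -/
def map (f : T ⟶ U) (hf : f ≫ u = s) (x : ComplexPoint s) : ComplexPoint u :=
  ⟨x.1 ≫ f, by rw [Category.assoc, hf, x.2]⟩

theorem pt_map (f : T ⟶ U) (hf : f ≫ u = s) (x : ComplexPoint s) :
    (x.map f hf).pt = f x.pt := rfl

theorem pt_injective [LocallyOfFiniteType s] :
    Function.Injective (pt : ComplexPoint s → T) := fun x y h =>
  Subtype.ext (ext_of_apply_closedPoint_eq s x.2 y.2 h)

/-- The Zariski topology on the set of complex points. -/
instance : TopologicalSpace (ComplexPoint s) := TopologicalSpace.induced pt inferInstance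

end ComplexPoint

namespace SmoothCurve

/-- Divisors on `C`: formal finite sums `∑ n_q · q` of points `q ∈ C(ℂ)`. -/
abbrev Div (C : SmoothCurve) : Type := ComplexPoint C.str →₀ ℤ

/-- The degree `∑ n_q` of a divisor. -/
def deg (C : SmoothCurve) : C.Div →+ ℤ := Finsupp.liftAddHom fun _ => AddMonoidHom.id ℤ

/-- The divisors `div f = ∑ ord_q(f) · q` of the nonzero rational functions `f` on `C`. -/
def principal (C : SmoothCurve) : AddSubgroup C.Div where
  carrier := {D | ∃ f : C.X.functionField, f ≠ 0 ∧ ∀ q, D q = C.X.ord f q.pt}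
  zero_mem' := by
    refine ⟨1, one_ne_zero, fun q => ?_⟩
    have h := Scheme.ord_mul (x := q.pt) (one_ne_zero (α := C.X.functionField)) one_ne_zero
    rw [mul_one] at h
    rw [Finsupp.zero_apply]
    omega
  add_mem' := by
    rintro D E ⟨f, hf, hD⟩ ⟨g, hg, hE⟩
    refine ⟨f * g, mul_ne_zero hf hg, fun q => ?_⟩
    rw [Scheme.ord_mul hf hg, Finsupp.add_apply, hD, hE]
  neg_mem' := by
    rintro D ⟨f, hf, hD⟩
    refine ⟨f⁻¹, inv_ne_zero hf, fun q => ?_⟩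
    have h1 := Scheme.ord_mul (x := q.pt) (one_ne_zero (α := C.X.functionField)) one_ne_zero
    have h2 := Scheme.ord_mul (x := q.pt) hf (inv_ne_zero hf)
    rw [mul_inv_cancel₀ hf] at h2
    rw [mul_one] at h1
    rw [Finsupp.neg_apply, hD]
    omega

/-- The Picard group of `C`: divisors modulo linear equivalence. -/
abbrev Pic (C : SmoothCurve) : Type := C.Div ⧸ C.principal

/-- The class in `Pic C` of a divisor, that is, the class of the line bundle `𝒪_C(D)`. -/
def cls (C : SmoothCurve) : C.Div →+ C.Pic := QuotientAddGroup.mk' C.principal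

/-- The subgroup `Pic⁰ C` of the classes of divisors of degree zero. -/
def pic0 (C : SmoothCurve) : AddSubgroup C.Pic := C.deg.ker.map C.cls

/-- The Jacobian `Jac(C) = Pic⁰(C)`. -/
def Jac (C : SmoothCurve) : Type := C.pic0

instance (C : SmoothCurve) : AddCommGroup C.Jac := inferInstanceAs (AddCommGroup C.pic0)

/-- The point of the Jacobian given by a divisor of degree zero. -/
def toJac (C : SmoothCurve) (D : C.Div) (hD : C.deg D = 0) : C.Jac :=
  ⟨C.cls D, AddSubgroup.mem_map_of_mem _ hD⟩

/-- The inclusion of `Jac(C)` in `Pic C`. -/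
def Jac.toPic {C : SmoothCurve} : C.Jac →+ C.Pic := C.pic0.subtype

/-- The divisor `(x_1 - y_1) + ⋯ + (x_d - y_d)`. -/
def diffDiv (C : SmoothCurve) {d : ℕ} (x y : Fin d → ComplexPoint C.str) : C.Div :=
  ∑ i, (Finsupp.single (x i) 1 - Finsupp.single (y i) 1)

theorem deg_diffDiv (C : SmoothCurve) {d : ℕ} (x y : Fin d → ComplexPoint C.str) :
    C.deg (C.diffDiv x y) = 0 := by
  simp only [deg, diffDiv, map_sum, map_sub]
  simp

/-- A family of points of the Jacobian: a scheme `T` locally of finite type over `ℂ`, together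
with `2d` morphisms `x_i, y_i : T ⟶ C` over `ℂ`. -/
structure JacFamily (C : SmoothCurve) where
  /-- the parameter scheme -/
  T : Scheme.{0}
  /-- its structure morphism -/
  str : T ⟶ Spec (.of ℂ)
  locallyOfFiniteType : LocallyOfFiniteType str
  /-- the number of pairs of points -/
  d : ℕ
  /-- the moving points with positive coefficients -/
  x : Fin d → (T ⟶ C.X)
  /-- the moving points with negative coefficients -/
  y : Fin d → (T ⟶ C.X)
  x_over : ∀ i, x i ≫ C.str = str
  y_over : ∀ i, y i ≫ C.str = str

/-- The map `T(ℂ) → Jac(C)`, `t ↦ [∑ (x_i(t) - y_i(t))]`, defined by a family. -/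
def JacFamily.classify {C : SmoothCurve} (F : C.JacFamily) (t : ComplexPoint F.str) : C.Jac :=
  C.toJac (C.diffDiv (fun i => t.map (F.x i) (F.x_over i)) fun i => t.map (F.y i) (F.y_over i))
    (C.deg_diffDiv _ _)

/-- The Zariski topology of the Jacobian variety. It is the quotient topology for the summation
maps `C^d × C^d → Jac(C)`, `(x, y) ↦ [∑ x_i - ∑ y_i]`; equivalently, it is the finest topology for
which the maps `T(ℂ) → Jac(C)` defined by all algebraic families of divisors of degree zero as
above are continuous. (These maps come from morphisms of varieties, so they are continuous for the
Zariski topology of the Jacobian variety; and for large `d` the summation map from the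
projective variety `C^d × C^d` is a closed surjection, so no finer topology has this property.) -/
instance (C : SmoothCurve) : TopologicalSpace C.Jac :=
  ⨆ F : C.JacFamily, TopologicalSpace.coinduced F.classify inferInstance

end SmoothCurve

/-- A covering morphism of curves: a finite morphism `C ⟶ C₀` over `ℂ`. (As the curves are
smooth, connected and complete, it is then surjective and flat.) -/
structure Covering (C C₀ : SmoothCurve) where
  /-- the underlying morphism of schemes -/
  hom : C.X ⟶ C₀.X
  hom_str : hom ≫ C₀.str = C.str
  finite : IsFinite hom

namespace Covering

variable {C C₀ : SmoothCurve} (α : Covering C C₀)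

instance : IsFinite α.hom := α.finite

/-- The map `C(ℂ) → C₀(ℂ)` on points. -/
def onPoints (q : ComplexPoint C.str) : ComplexPoint C₀.str := q.map α.hom α.hom_str

/-- The degree of `α`: the rank of `α_* 𝒪_C` over `𝒪_{C₀}` at the generic point of `C₀`. -/
def degree : ℕ := α.hom.finrank (genericPoint C₀.X)

/-- The ramification index of `α` at `q`: the length of the local ring at `q` of the
scheme-theoretic fibre of `α` through `q`. -/
def ramIdx (q : ComplexPoint C.str) : ℕ :=
  (Module.length (C.X.presheaf.stalk q.pt)
    (C.X.presheaf.stalk q.pt ⧸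
      (IsLocalRing.maximalIdeal (C₀.X.presheaf.stalk (α.hom q.pt))).map
        (α.hom.stalkMap q.pt).hom)).toNat

theorem finite_fiber (p : ComplexPoint C₀.str) : (α.onPoints ⁻¹' {p}).Finite := by
  have h := (α.hom.finite_preimage_singleton p.pt).preimage
    (ComplexPoint.pt_injective (s := C.str)).injOn
  refine h.subset fun q hq => ?_
  have hq' : α.onPoints q = p := hq
  change α.hom q.pt = p.pt
  rw [← hq']
  rfl

/-- The pull-back of divisors: `α^* p = ∑_{α(q) = p} e_α(q) · q`, extended linearly. -/
def pullbackDiv (D : C₀.Div) : C.Div :=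
  Finsupp.ofSupportFinite (fun q => (α.ramIdx q : ℤ) * D (α.onPoints q)) <| by
    refine (D.hasFiniteSupport.preimage' fun p _ => α.finite_fiber p).subset fun q hq => ?_
    simp only [Function.mem_support, ne_eq, mul_eq_zero, not_or] at hq
    exact hq.2

/-- The norm (push-forward) of divisors: `∑ n_q · q ↦ ∑ n_q · α(q)`. -/
def normDiv : C.Div →+ C₀.Div := Finsupp.mapDomain.addMonoidHom α.onPoints

/-- `φ` is the pull-back homomorphism `α^* : Jac(C₀) → Jac(C)`, `[D] ↦ [α^* D]`. This determines
`φ`, because every point of `Jac(C₀)` is the class of a divisor of degree zero. -/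
def IsPullbackHom (φ : C₀.Jac →+ C.Jac) : Prop :=
  ∀ (D : C₀.Div) (hD : C₀.deg D = 0), (φ (C₀.toJac D hD)).toPic = C.cls (α.pullbackDiv D)

/-- `N` is the norm homomorphism `N_α : Jac(C) → Jac(C₀)`, `[∑ n_q · q] ↦ [∑ n_q · α(q)]`. This
determines `N`, because every point of `Jac(C)` is the class of a divisor of degree zero. -/
def IsNormHom (N : C.Jac →+ C₀.Jac) : Prop :=
  ∀ (D : C.Div) (hD : C.deg D = 0), (N (C.toJac D hD)).toPic = C₀.cls (α.normDiv D)

/-- `α` is a locally cyclic covering of degree `r`: it has degree `r`, and there is a point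
`p ∈ C₀` such that `α^* p = r · q` for some `q ∈ C`. -/
def IsLocallyCyclic (r : ℕ) : Prop :=
  α.degree = r ∧ ∃ (p : ComplexPoint C₀.str) (q : ComplexPoint C.str),
    α.pullbackDiv (Finsupp.single p 1) = Finsupp.single q (r : ℤ)

end Covering

end

/-!
Let `α : C ⟶ C₀` be a finite morphism of smooth complete curves over `ℂ`, of degree `n`, and let `q`
be a point of `C` which is alone in its fibre, so that `α^* α(q) = n · q`. Everything rests on the
dictionary between points of `C` and primes of the Dedekind domains of functions on affine open
subsets: it gives `deg α^* p = n`, `div (α^* f) = α^* (div f)` and `div (N_α f) = α_* (div f)`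
(`Covering.sum_ramIdx_fiber`, `Covering.ord_pullbackFun`, `Covering.ord_normFun`), so both
homomorphisms of Jacobians are defined.

*The pull-back is injective.* Let `α^* D = div f`. After changing `D` by a principal divisor, `f` is
a unit at `q`, and after scaling it takes the value `1` there. The functions `f ^ n` and
`α^* N_α(f)` have the same divisor, so `f ^ n` is a function on `C₀`, and the conjugates of `f` in
`ℂ(C)` are the multiples of `f` by certain roots of unity. As `q` is totally ramified, the norm
determines the valuation at `q`, so conjugate functions have the same valuation there. Comparing
`f - 1` with its conjugates, we see that `f` is its only conjugate (`mem_range_of_pow_mem_range`).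
So `f = α^* g`, and `D = div g`.

*The kernel of the norm is connected.* Let `α_* D = div g`. By Tsen's theorem `g` is a norm, so `D`
can be changed by a principal divisor to achieve `α_* D = 0`. Tsen's theorem is proved by counting
(`MvPolynomial.exists_ne_zero_eval_eq_zero_polynomial`): the norm form minus `g y ^ n` is a form of
degree `n` in `n + 1` variables, and over `ℂ(t)` a nontrivial zero of it is found among polynomials
in `t` of large degree, because their coefficients are more numerous than the equations between
them; fewer equations than unknowns are solvable by Krull's height theorem and the Nullstellensatz.

A divisor `D` with `α_* D = 0` is a sum of differences `a - b` with `α(a) = α(b)`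
(`Covering.exists_diffDiv_eq`), where `(a, b)` is a point of `C ×_{C₀} C`. As `α` is flat, `(a, b)`
lies on an irreducible closed subset of `C ×_{C₀} C` which maps onto `C`
(`Covering.exists_irreducible`), and this subset contains the only point `(q, q)` over `q`. Along
it, `a - b` moves to `q - q = 0` while the class of the divisor stays in the kernel of the norm.
Doing this for one difference after the other joins the class of `D` to `0`.
-/

noncomputable section

/-! ### Local rings of smooth curves -/

section LocalAlgebra

open IsLocalRing KaehlerDifferential TensorProduct

/-- At a rational point of a formally smooth local algebra, the conormal sequence identifies the
cotangent space with the fibre of the module of differentials. -/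
theorem finrank_cotangentSpace_eq_finrank_kaehlerDifferential (k S : Type*) [Field k] [CommRing S]
    [IsLocalRing S] [Algebra k S] [Algebra.FormallySmooth k S] [Module.Free S Ω[S⁄k]]
    (hk : Function.Bijective (algebraMap k (ResidueField S))) :
    Module.finrank (ResidueField S) (CotangentSpace S) = Module.finrank S Ω[S⁄k] := by
  have hs : Function.Surjective (algebraMap S (ResidueField S)) := residue_surjective
  have : Algebra.FormallySmooth k (ResidueField S) :=
    Algebra.FormallySmooth.of_equiv (AlgEquiv.ofBijective (Algebra.ofId k (ResidueField S)) hk)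
  have : Subsingleton Ω[ResidueField S⁄k] := by
    have := Algebra.FormallyUnramified.of_surjective (Algebra.ofId k (ResidueField S)) hk.2
    infer_instance
  have inj : Function.Injective (kerCotangentToTensor k S (ResidueField S)) :=
    (Algebra.FormallySmooth.kerCotangentToTensor_injective_iff hs).2 inferInstance
  have surj : Function.Surjective (kerCotangentToTensor k S (ResidueField S)) := fun x ↦
    (exact_kerCotangentToTensor_mapBaseChange k S (ResidueField S) hs x).1 (Subsingleton.elim _ _)
  have key : Nonempty ((maximalIdeal S).Cotangent ≃ₗ[S] ResidueField S ⊗[S] Ω[S⁄k]) :=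
    (ker_residue (R := S) : RingHom.ker (algebraMap S (ResidueField S)) = _) ▸
      ⟨LinearEquiv.ofBijective _ ⟨inj, surj⟩⟩
  obtain ⟨e⟩ := key
  let e' : CotangentSpace S ≃ₗ[ResidueField S] ResidueField S ⊗[S] Ω[S⁄k] :=
    e.extendScalarsOfSurjective hs
  rw [e'.finrank_eq, Module.finrank_baseChange]

theorem bijective_algebraMap_residueField_of_isMaximal (k R S : Type*) [Field k] [IsAlgClosed k]
    [CommRing R] [Algebra k R] [Algebra.FiniteType k R] (M : Ideal R) [M.IsMaximal]
    [CommRing S] [IsLocalRing S] [Algebra R S] [Algebra k S] [IsScalarTower k R S]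
    [IsLocalization.AtPrime S M] :
    Function.Bijective (algebraMap k (ResidueField S)) := by
  let := Ideal.Quotient.field M
  have h1 : Function.Bijective (algebraMap k (R ⧸ M)) := by
    have : Module.Finite k (R ⧸ M) := finite_of_finite_type_of_isJacobsonRing k (R ⧸ M)
    exact IsAlgClosed.algebraMap_bijective_of_isIntegral
  have h2 := (IsLocalization.AtPrime.equivQuotMaximalIdeal M S).bijective
  have h3 : algebraMap k (ResidueField S) =
      (RingEquiv.toRingHom (S := ResidueField S)
        (IsLocalization.AtPrime.equivQuotMaximalIdeal M S)).comp (algebraMap k (R ⧸ M)) := by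
    ext x
    rw [RingHom.comp_apply, IsScalarTower.algebraMap_apply k R (R ⧸ M),
      IsScalarTower.algebraMap_apply k S (ResidueField S), IsScalarTower.algebraMap_apply k R S]
    rfl
  rw [h3]
  exact h2.comp h1

/-- The local rings of a standard smooth algebra of relative dimension `1` at maximal ideals are
discrete valuation rings, since their cotangent spaces have dimension `1`. -/
theorem isDiscreteValuationRing_of_isStandardSmooth (k R S : Type*) [Field k] [IsAlgClosed k]
    [CommRing R] [Nontrivial R] [Algebra k R] [Algebra.IsStandardSmoothOfRelativeDimension 1 k R]
    (M : Ideal R) [M.IsMaximal]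
    [CommRing S] [IsDomain S] [Algebra R S] [IsLocalization.AtPrime S M] :
    IsDiscreteValuationRing S := by
  have : Algebra.IsStandardSmooth k R :=
    Algebra.IsStandardSmoothOfRelativeDimension.isStandardSmooth 1
  have : IsNoetherianRing R := Algebra.FiniteType.isNoetherianRing k R
  have : IsNoetherianRing S := IsLocalization.isNoetherianRing M.primeCompl S inferInstance
  have : IsLocalRing S := IsLocalization.AtPrime.isLocalRing S M
  let : Algebra k S := ((algebraMap R S).comp (algebraMap k R)).toAlgebra
  have : IsScalarTower k R S := .of_algebraMap_eq' rfl
  have := Algebra.FormallyEtale.of_isLocalization (Rₘ := S) M.primeCompl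
  have : Algebra.FormallySmooth k S := .comp k R S
  let e := tensorKaehlerEquivOfFormallyEtale k R S
  have : Module.Free S Ω[S⁄k] := .of_equiv e
  rw [← IsLocalRing.finrank_CotangentSpace_eq_one_iff,
    finrank_cotangentSpace_eq_finrank_kaehlerDifferential k S
      (bijective_algebraMap_residueField_of_isMaximal k R S M), ← e.finrank_eq,
    Module.finrank_baseChange]
  have := Algebra.IsStandardSmoothOfRelativeDimension.rank_kaehlerDifferential (R := k) (S := R) 1
  exact Module.finrank_eq_of_rank_eq this

theorem isDedekindDomain_of_isDiscreteValuationRing (R : Type*) [CommRing R] [IsDomain R]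
    [IsNoetherianRing R]
    (H : ∀ (M : Ideal R) [M.IsMaximal], IsDiscreteValuationRing (Localization.AtPrime M)) :
    IsDedekindDomain R where
  toIsNoetherian := inferInstance
  maximalOfPrime {P} hP _ := by
    obtain ⟨M, hM, hle⟩ := Ideal.exists_le_maximal P (Ideal.IsPrime.ne_top ‹_›)
    let o := IsLocalization.AtPrime.orderIsoOfPrime (Localization.AtPrime M) M
    let Q := o.symm ⟨P, ‹_›, hle⟩
    have hQ : Q.1.IsPrime := Q.2
    have hc : Q.1.comap (algebraMap R (Localization.AtPrime M)) = P :=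
      congrArg Subtype.val (o.apply_symm_apply ⟨P, ‹_›, hle⟩)
    have hQ0 : Q.1 ≠ ⊥ := by
      intro h
      rw [h, ← RingHom.ker_eq_comap_bot, (RingHom.injective_iff_ker_eq_bot _).1
        (IsLocalization.injective _ M.primeCompl_le_nonZeroDivisors)] at hc
      exact hP hc.symm
    have hm : Q.1 = maximalIdeal _ := IsLocalRing.eq_maximalIdeal (hQ.isMaximal hQ0)
    have hu := Localization.AtPrime.under_maximalIdeal (I := M)
    rw [hm] at hc
    exact (hc.symm.trans hu) ▸ hM
  toIsIntegralClosure := by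
    have : IsIntegrallyClosed R := IsIntegrallyClosed.of_localization_maximal fun M _ hM ↦ by
      infer_instance
    infer_instance

end LocalAlgebra

/-! ### Orders of vanishing as valuations of Dedekind domains -/

namespace SmoothCurve

variable (C : SmoothCurve)

instance : JacobsonSpace C.X := LocallyOfFiniteType.jacobsonSpace C.str

theorem isDiscreteValuationRing_stalk {x : C.X} (hx : IsClosed {x}) :
    IsDiscreteValuationRing (C.X.presheaf.stalk x) := by
  obtain ⟨U, hU, V, hV, hxV, e, H⟩ :=
    SmoothOfRelativeDimension.exists_isStandardSmoothOfRelativeDimension (n := 1) (f := C.str) x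
  have hU' : U = ⊤ := by
    have hm : C.str x ∈ U := e hxV
    ext y
    simpa [Subsingleton.elim y (C.str x)] using hm
  subst hU'
  have H' := RingHom.isStandardSmoothOfRelativeDimension_respectsIso.2
    (C.str.appLE ⊤ V e).hom (Scheme.ΓSpecIso (.of ℂ)).symm.commRingCatIsoToRingEquiv H
  let := RingHom.toAlgebra ((C.str.appLE ⊤ V e).hom.comp
    (Scheme.ΓSpecIso (.of ℂ)).symm.commRingCatIsoToRingEquiv.toRingHom)
  have : Algebra.IsStandardSmoothOfRelativeDimension 1 ℂ Γ(C.X, V) := H'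
  have : Nonempty V := ⟨⟨x, hxV⟩⟩
  let := C.X.presheaf.algebra_section_stalk (⟨x, hxV⟩ : V)
  have := hV.primeIdealOf_isMaximal_of_isClosed ⟨x, hxV⟩ hx
  have := hV.isLocalization_stalk ⟨x, hxV⟩
  exact isDiscreteValuationRing_of_isStandardSmooth ℂ Γ(C.X, V) _
    (hV.primeIdealOf ⟨x, hxV⟩).asIdeal

theorem coheight_eq_one {x : C.X} (hx : IsClosed {x}) : Order.coheight x = 1 := by
  have := C.isDiscreteValuationRing_stalk hx
  have h := ringKrullDim_stalk_eq_coheight x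
  rw [IsDiscreteValuationRing.ringKrullDim_eq_one] at h
  exact_mod_cast h.symm

theorem isClosed_pt {T : Scheme.{0}} {s : T ⟶ Spec (.of ℂ)} [LocallyOfFiniteType s]
    (q : ComplexPoint s) : IsClosed {q.pt} :=
  (pointEquivClosedPoint s q).2

theorem exists_pt_eq {T : Scheme.{0}} {s : T ⟶ Spec (.of ℂ)} [LocallyOfFiniteType s] {x : T}
    (hx : IsClosed {x}) : ∃ q : ComplexPoint s, q.pt = x :=
  ⟨(pointEquivClosedPoint s).symm ⟨x, hx⟩,
    congrArg Subtype.val ((pointEquivClosedPoint s).apply_symm_apply ⟨x, hx⟩)⟩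

variable {C} {U : C.X.Opens} (hU : IsAffineOpen U)

include hU in
theorem isNoetherianRing_sections : IsNoetherianRing Γ(C.X, U) :=
  IsLocallyNoetherian.component_noetherian ⟨U, hU⟩

theorem exists_primeIdealOf_eq (M : Ideal Γ(C.X, U)) [M.IsMaximal] :
    ∃ (q : ComplexPoint C.str) (hq : q.pt ∈ U), (hU.primeIdealOf ⟨q.pt, hq⟩).asIdeal = M := by
  let m : Spec Γ(C.X, U) := ⟨M, inferInstance⟩
  have hm : IsClosed {m} := (PrimeSpectrum.isClosed_singleton_iff_isMaximal m).2 ‹_›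
  have hx : hU.fromSpec m ∈ U := by
    have : hU.fromSpec m ∈ Set.range hU.fromSpec := ⟨m, rfl⟩
    rwa [hU.range_fromSpec] at this
  have hc : IsClosed {hU.fromSpec m} := by
    have : m ∈ hU.fromSpec ⁻¹' closedPoints C.X :=
      hU.fromSpec.isOpenEmbedding.preimage_closedPoints.symm ▸ hm
    exact this
  obtain ⟨q, hq⟩ := exists_pt_eq (s := C.str) hc
  refine ⟨q, hq ▸ hx, ?_⟩
  have : hU.primeIdealOf ⟨q.pt, hq ▸ hx⟩ = m := by
    apply hU.fromSpec.isOpenEmbedding.injective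
    exact (hU.fromSpec_primeIdealOf _).trans hq
  rw [this]

include hU in
theorem isDedekindDomain_sections [Nonempty U] : IsDedekindDomain Γ(C.X, U) := by
  have := isNoetherianRing_sections hU
  refine isDedekindDomain_of_isDiscreteValuationRing _ fun M _ ↦ ?_
  obtain ⟨q, hq, rfl⟩ := exists_primeIdealOf_eq hU M
  have := C.isDiscreteValuationRing_stalk (isClosed_pt q)
  let := C.X.presheaf.algebra_section_stalk (⟨q.pt, hq⟩ : U)
  have := hU.isLocalization_stalk ⟨q.pt, hq⟩
  exact IsDiscreteValuationRing.RingEquivClass.isDiscreteValuationRing (IsLocalization.algEquiv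
    (hU.primeIdealOf ⟨q.pt, hq⟩).asIdeal.primeCompl (C.X.presheaf.stalk q.pt)
    (Localization.AtPrime (hU.primeIdealOf ⟨q.pt, hq⟩).asIdeal)).toRingEquiv

theorem primeIdealOf_ne_bot {q : ComplexPoint C.str} (hq : q.pt ∈ U) :
    (hU.primeIdealOf ⟨q.pt, hq⟩).asIdeal ≠ ⊥ := by
  intro h
  have := C.isDiscreteValuationRing_stalk (isClosed_pt q)
  let := C.X.presheaf.algebra_section_stalk (⟨q.pt, hq⟩ : U)
  have := hU.isLocalization_stalk ⟨q.pt, hq⟩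
  apply IsDiscreteValuationRing.not_a_field (C.X.presheaf.stalk q.pt)
  rw [← IsLocalization.AtPrime.map_eq_maximalIdeal (hU.primeIdealOf ⟨q.pt, hq⟩).asIdeal
    (C.X.presheaf.stalk q.pt), h, Ideal.map_bot]

/-- The prime of the coordinate ring of an affine open `U` that is the ideal of functions
vanishing at the complex point `q ∈ U`. -/
def primeAt (q : ComplexPoint C.str) (hq : q.pt ∈ U) :
    IsDedekindDomain.HeightOneSpectrum Γ(C.X, U) where
  asIdeal := (hU.primeIdealOf ⟨q.pt, hq⟩).asIdeal
  isPrime := (hU.primeIdealOf ⟨q.pt, hq⟩).isPrime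
  ne_bot := primeIdealOf_ne_bot hU hq

theorem primeAt_isMaximal (q : ComplexPoint C.str) (hq : q.pt ∈ U) :
    (primeAt hU q hq).asIdeal.IsMaximal :=
  hU.primeIdealOf_isMaximal_of_isClosed ⟨q.pt, hq⟩ (isClosed_pt q)

theorem exists_primeAt_eq (v : IsDedekindDomain.HeightOneSpectrum Γ(C.X, U))
    (hv : v.asIdeal.IsMaximal) :
    ∃ (q : ComplexPoint C.str) (hq : q.pt ∈ U), primeAt hU q hq = v := by
  obtain ⟨q, hq, h⟩ := exists_primeIdealOf_eq hU v.asIdeal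
  exact ⟨q, hq, IsDedekindDomain.HeightOneSpectrum.ext h⟩

theorem primeAt_injective {q q' : ComplexPoint C.str} {hq : q.pt ∈ U} {hq' : q'.pt ∈ U}
    (h : primeAt hU q hq = primeAt hU q' hq') : q = q' := by
  apply ComplexPoint.pt_injective
  have h' : hU.primeIdealOf ⟨q.pt, hq⟩ = hU.primeIdealOf ⟨q'.pt, hq'⟩ :=
    PrimeSpectrum.ext (congrArg (fun v ↦ v.asIdeal) h)
  have := congrArg hU.fromSpec h'
  rwa [hU.fromSpec_primeIdealOf, hU.fromSpec_primeIdealOf] at this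

/-- The valuation attached to a prime does not change on passing to the local ring at it. -/
theorem valuation_localization_eq {R S K : Type*} [CommRing R] [IsDedekindDomain R] [CommRing S]
    [IsDomain S] [IsDiscreteValuationRing S] [Field K] [Algebra R S] [Algebra R K] [Algebra S K]
    [IsScalarTower R S K] [IsFractionRing R K] [IsFractionRing S K]
    (v : IsDedekindDomain.HeightOneSpectrum R) [IsLocalization.AtPrime S v.asIdeal] (x : K) :
    (IsDiscreteValuationRing.maximalIdeal S).valuation K x = v.valuation K x := by
  have hinj : Function.Injective (algebraMap R S) :=
    IsLocalization.injective S v.asIdeal.primeCompl_le_nonZeroDivisors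
  have : Module.IsTorsionFree R S := by
    rwa [Module.isTorsionFree_iff_algebraMap_injective]
  have hm := IsLocalization.AtPrime.map_eq_maximalIdeal v.asIdeal S
  have : (IsDiscreteValuationRing.maximalIdeal S).asIdeal.LiesOver v.asIdeal :=
    ⟨(IsLocalization.AtPrime.under_maximalIdeal S v.asIdeal).symm⟩
  have h := IsDedekindDomain.HeightOneSpectrum.valuation_liesOver (K := K) K v
    (IsDiscreteValuationRing.maximalIdeal S) x
  have he : v.asIdeal.ramificationIdx' (IsDiscreteValuationRing.maximalIdeal S).asIdeal = 1 := by
    have h1 : (IsDiscreteValuationRing.maximalIdeal S).asIdeal =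
      v.asIdeal.map (algebraMap R S) := hm.symm
    rw [h1]
    exact Ideal.ramificationIdx'_map_self_eq_one (hm ▸ Ideal.IsPrime.ne_top inferInstance)
      (hm ▸ IsDiscreteValuationRing.not_a_field S)
  rw [he, pow_one] at h
  exact h.symm

/-- The order of vanishing of the scheme at a closed point is the additive form of the valuation
of the Dedekind domain of functions on an affine neighbourhood. -/
theorem valuation_eq_exp_neg_ord [Nonempty U] [IsDedekindDomain Γ(C.X, U)]
    [IsFractionRing Γ(C.X, U) C.X.functionField] (q : ComplexPoint C.str) (hq : q.pt ∈ U)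
    {f : C.X.functionField} (hf : f ≠ 0) :
    (primeAt hU q hq).valuation C.X.functionField f = WithZero.exp (-C.X.ord f q.pt) := by
  have := C.isDiscreteValuationRing_stalk (isClosed_pt q)
  let := C.X.presheaf.algebra_section_stalk (⟨q.pt, hq⟩ : U)
  have : IsLocalization.AtPrime (C.X.presheaf.stalk q.pt) (primeAt hU q hq).asIdeal :=
    hU.isLocalization_stalk ⟨q.pt, hq⟩
  have : IsScalarTower Γ(C.X, U) (C.X.presheaf.stalk q.pt) C.X.functionField :=
    functionField_isScalarTower C.X U ⟨q.pt, hq⟩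
  rw [← valuation_localization_eq (S := C.X.presheaf.stalk q.pt)]
  have h := (Scheme.ord_eq_iff (C.coheight_eq_one (isClosed_pt q)) hf).1 rfl
  rw [Scheme.ordHom, Ring.ordFrac_eq_valuation_inv] at h
  rw [WithZero.exp_neg, ← inv_inv (((IsDiscreteValuationRing.maximalIdeal _).valuation _) f), h]
  rfl

end SmoothCurve

/-! ### Norms and valuations in extensions of Dedekind domains -/

section DedekindExtension

open IsDedekindDomain HeightOneSpectrum

variable {A B : Type*} [CommRing A] [IsDedekindDomain A] [CommRing B] [IsDedekindDomain B]
  [Algebra A B] [Module.Finite A B] [Module.IsTorsionFree A B]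

/-- The fundamental identity `∑ e = n` of an extension of Dedekind domains with trivial residue
field extensions. The primes over `v` are given by a finite set `S` of points of the spectrum. -/
theorem sum_ramificationIdx_eq_finrank {v : HeightOneSpectrum A}
    {S : Finset (HeightOneSpectrum B)} (hS : ∀ w, w ∈ S ↔ w.asIdeal.LiesOver v.asIdeal)
    (hdeg : ∀ w ∈ S, w.asIdeal.inertiaDeg A = 1) :
    ∑ w ∈ S, w.asIdeal.ramificationIdx A = Module.finrank A B := by
  rw [← Ideal.sum_ramification_inertia_eq_finrank v.asIdeal B]
  refine Finset.sum_bij (fun w hw ↦ ⟨w.asIdeal, w.isPrime, (hS w).1 hw⟩)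
    (fun _ _ ↦ Finset.mem_univ _) (fun w _ w' _ h ↦ HeightOneSpectrum.ext (congrArg Subtype.val h))
    (fun Q _ ↦ ?_)
    (fun w hw ↦ by simp [hdeg w hw])
  have hQ : Q.1.LiesOver v.asIdeal := Q.2.2
  refine ⟨⟨Q.1, Q.2.1, ?_⟩, (hS _).2 hQ, rfl⟩
  exact Ideal.ne_bot_of_liesOver_of_ne_bot v.ne_bot Q.1

theorem emultiplicity_asIdeal_self {R : Type*} [CommRing R] [IsDedekindDomain R]
    (v : HeightOneSpectrum R) : emultiplicity v.asIdeal v.asIdeal = 1 :=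
  (FiniteMultiplicity.of_prime_left v.prime v.prime.ne_zero).emultiplicity_self

theorem emultiplicity_relNorm [PerfectField (FractionRing A)] {v : HeightOneSpectrum A}
    {S : Finset (HeightOneSpectrum B)} (hS : ∀ w, w ∈ S ↔ w.asIdeal.LiesOver v.asIdeal)
    (hdeg : ∀ w : HeightOneSpectrum B, w.asIdeal.inertiaDeg A = 1) {I : Ideal B} (hI : I ≠ 0) :
    emultiplicity v.asIdeal (Ideal.relNorm A I) = ∑ w ∈ S, emultiplicity w.asIdeal I := by
  classical
  induction I using UniqueFactorizationMonoid.induction_on_prime with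
  | h₁ => exact absurd rfl hI
  | h₂ I h =>
    rw [emultiplicity_of_isUnit_right v.prime.not_isUnit (h.map _)]
    exact (Finset.sum_eq_zero fun w _ ↦ emultiplicity_of_isUnit_right w.prime.not_isUnit h).symm
  | h₃ I P hI' hP ih =>
    have hP0 : P ≠ ⊥ := hP.ne_zero
    have hPp : P.IsPrime := Ideal.isPrime_of_prime hP
    let u : HeightOneSpectrum B := ⟨P, hPp, hP0⟩
    have hPm : P.IsMaximal := u.isMaximal
    have key : emultiplicity v.asIdeal (Ideal.relNorm A P) =
        ∑ w ∈ S, emultiplicity w.asIdeal P := by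
      have hm : (P.under A).IsMaximal := Ideal.isMaximal_comap_of_isIntegral_of_isMaximal P
      rw [Ideal.relNorm_eq_pow_of_isMaximal P (P.under A),
        show P.inertiaDeg A = 1 from hdeg u, pow_one]
      have hw (w : HeightOneSpectrum B) : emultiplicity w.asIdeal P = if w = u then 1 else 0 := by
        split_ifs with h
        · subst h; exact emultiplicity_asIdeal_self u
        · rw [emultiplicity_eq_zero]
          intro h'
          exact h (HeightOneSpectrum.ext
            ((hPm.eq_of_le w.isPrime.ne_top (Ideal.le_of_dvd h')).symm))
      simp_rw [hw]
      rw [Finset.sum_ite_eq' S u]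
      have hmem : u ∈ S ↔ P.under A = v.asIdeal := by
        rw [hS]
        exact ⟨fun h ↦ h.over.symm, fun h ↦ ⟨h.symm⟩⟩
      split_ifs with h
      · rw [hmem.1 h]; exact emultiplicity_asIdeal_self v
      · rw [emultiplicity_eq_zero]
        intro h'
        exact h (hmem.2 (hm.eq_of_le v.isPrime.ne_top (Ideal.le_of_dvd h')))
    rw [map_mul, emultiplicity_mul v.prime, key, ih hI', ← Finset.sum_add_distrib]
    exact Finset.sum_congr rfl fun w _ ↦ (emultiplicity_mul w.prime).symm

theorem WithZero.exp_finsetSum {ι : Type*} (s : Finset ι) (f : ι → ℤ) :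
    WithZero.exp (∑ i ∈ s, f i) = ∏ i ∈ s, WithZero.exp (f i) := by
  induction s using Finset.cons_induction with
  | empty => simp
  | cons a s ha ih => rw [Finset.sum_cons, Finset.prod_cons, WithZero.exp_add, ih]

variable (K L : Type*) [Field K] [Field L] [Algebra K L]
  [Algebra A K] [IsFractionRing A K] [Algebra A L] [IsScalarTower A K L]
  [Algebra B L] [IsFractionRing B L] [IsScalarTower A B L]

/-- The valuation at `v` of a norm is the product of the valuations at the primes over `v`, when
the residue field extensions are trivial. -/
theorem valuation_norm [PerfectField (FractionRing A)] {v : HeightOneSpectrum A}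
    {S : Finset (HeightOneSpectrum B)} (hS : ∀ w, w ∈ S ↔ w.asIdeal.LiesOver v.asIdeal)
    (hne : S.Nonempty)
    (hdeg : ∀ w : HeightOneSpectrum B, w.asIdeal.inertiaDeg A = 1) [FiniteDimensional K L] (x : L) :
    v.valuation K (Algebra.norm K x) = ∏ w ∈ S, w.valuation L x := by
  have key (b : B) (hb : b ≠ 0) : v.valuation K (Algebra.norm K (algebraMap B L b)) =
      ∏ w ∈ S, w.valuation L (algebraMap B L b) := by
    have hn : Algebra.intNorm A B b ≠ 0 := Algebra.intNorm_ne_zero.2 hb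
    have h0 : Ideal.span {b} ≠ 0 := by simpa using hb
    have h1 := emultiplicity_relNorm hS hdeg h0
    rw [Ideal.relNorm_singleton] at h1
    have h2 : multiplicity v.asIdeal (Ideal.span {Algebra.intNorm A B b}) =
        ∑ w ∈ S, multiplicity w.asIdeal (Ideal.span {b}) := by
      rw [FiniteMultiplicity.emultiplicity_eq_multiplicity
        (FiniteMultiplicity.of_prime_left v.prime (by simpa using hn)),
        Finset.sum_congr rfl fun w _ ↦ FiniteMultiplicity.emultiplicity_eq_multiplicity
        (FiniteMultiplicity.of_prime_left w.prime h0)] at h1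
      exact_mod_cast h1
    rw [← Algebra.algebraMap_intNorm (A := A), valuation_of_algebraMap,
      intValuation_eq_exp_neg_multiplicity _ hn, h2]
    simp_rw [valuation_of_algebraMap, intValuation_eq_exp_neg_multiplicity _ hb]
    push_cast
    rw [← Finset.sum_neg_distrib]
    exact WithZero.exp_finsetSum S _
  obtain ⟨a, b, hb, rfl⟩ := IsFractionRing.div_surjective (A := B) x
  have hb0 : b ≠ 0 := nonZeroDivisors.ne_zero hb
  rcases eq_or_ne a 0 with rfl | ha
  · simp [Algebra.norm_zero, Finset.prod_const, hne.card_ne_zero]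
  · simp_rw [map_div₀]
    rw [div_eq_mul_inv, map_mul, Algebra.norm_inv, ← div_eq_mul_inv, map_div₀, key a ha, key b hb0,
      Finset.prod_div_distrib]

omit [Module.Finite A B] in
theorem valuation_algebraMap_eq_pow (v : HeightOneSpectrum A) (w : HeightOneSpectrum B)
    [w.asIdeal.LiesOver v.asIdeal] (x : K) :
    w.valuation L (algebraMap K L x) = v.valuation K x ^ w.asIdeal.ramificationIdx A := by
  rw [← Ideal.ramificationIdx'_eq_ramificationIdx v.asIdeal w.asIdeal v.ne_bot,
    valuation_liesOver L]

end DedekindExtension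

section Kummer

open Polynomial IntermediateField

/-- Conjugate elements have the same norm. -/
theorem norm_eq_of_minpoly_eq {K L : Type*} [Field K] [Field L] [Algebra K L]
    [FiniteDimensional K L] [Algebra.IsSeparable K L] {x y : L} (h : minpoly K x = minpoly K y) :
    Algebra.norm K x = Algebra.norm K y := by
  have hx := Algebra.IsIntegral.isIntegral (R := K) x
  have hy := Algebra.IsIntegral.isIntegral (R := K) y
  have hd : (minpoly K x).natDegree = (minpoly K y).natDegree := by rw [h]
  have hr : Module.finrank K⟮x⟯ L = Module.finrank K⟮y⟯ L := by
    have h1 := Module.finrank_mul_finrank K K⟮x⟯ L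
    have h2 := Module.finrank_mul_finrank K K⟮y⟯ L
    rw [adjoin.finrank hx] at h1
    rw [adjoin.finrank hy, ← hd, ← h1] at h2
    exact (Nat.eq_of_mul_eq_mul_left (minpoly.natDegree_pos hx) h2).symm
  rw [Algebra.norm_eq_norm_adjoin K x, Algebra.norm_eq_norm_adjoin K y, hr]
  congr 1
  have gx := Algebra.PowerBasis.norm_gen_eq_coeff_zero_minpoly (adjoin.powerBasis hx)
  have gy := Algebra.PowerBasis.norm_gen_eq_coeff_zero_minpoly (adjoin.powerBasis hy)
  rw [adjoin.powerBasis_gen, adjoin.powerBasis_dim, minpoly_gen] at gx gy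
  rw [gx, gy, h]

theorem mem_range_algebraMap_of_pow_eq_one {k L : Type*} [Field k] [IsAlgClosed k] [Field L]
    [Algebra k L] {n : ℕ} (hn : n ≠ 0) {x : L} (hx : x ^ n = 1) :
    x ∈ Set.range (algebraMap k L) := by
  have hi : IsIntegral k x := .of_pow (Nat.pos_of_ne_zero hn) (hx ▸ isIntegral_one)
  exact minpoly.mem_range_of_degree_eq_one k x
    (IsAlgClosed.degree_eq_one_of_irreducible k (minpoly.irreducible hi))

/-- Let `v (N x) = w x` for all `x ∈ L`, as for a totally ramified extension of valuations, and let
`w` be trivial on `k`. If `h ∈ L` is congruent to `1` at `w` and has a power in `K`, then `h ∈ K`: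
a conjugate of `h` is `c h` with `c ∈ k` a root of unity, and as `h - 1` and `c h - 1` have the same
norm they have the same value at `w`, so that `c = 1`. -/
theorem mem_range_of_pow_mem_range (k : Type*) {K L Γ : Type*} [Field k] [IsAlgClosed k]
    [CharZero k] [Field K] [Field L] [Algebra k L] [Algebra K L] [CharZero K]
    [FiniteDimensional K L] [LinearOrderedCommGroupWithZero Γ]
    (v : Valuation K Γ) (w : Valuation L Γ) (hvw : ∀ x, v (Algebra.norm K x) = w x)
    (hk : ∀ c : k, c ≠ 0 → w (algebraMap k L c) = 1) {h : L} (hh : w (1 - h) < 1)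
    {n : ℕ} (hn : n ≠ 0) (hpow : h ^ n ∈ Set.range (algebraMap K L)) :
    h ∈ Set.range (algebraMap K L) := by
  have hi : IsIntegral K h := Algebra.IsIntegral.isIntegral h
  obtain ⟨g, hg⟩ := hpow
  have hw : w h = 1 := by
    have := Valuation.map_one_sub_of_lt w hh
    simpa using this
  have h0 : h ≠ 0 := by rintro rfl; simp at hw
  by_contra hnot
  -- `X ^ n - h ^ n` splits in `L`, hence so does the minimal polynomial of `h`
  have : NeZero (n : k) := ⟨Nat.cast_ne_zero.2 hn⟩
  obtain ⟨ζ, hζ⟩ := HasEnoughRootsOfUnity.exists_primitiveRoot k n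
  have hirr := minpoly.irreducible hi
  have hdvd : minpoly K h ∣ X ^ n - C g := minpoly.dvd K h (by simp [hg])
  have hsplit : ((minpoly K h).map (algebraMap K L)).Splits := by
    refine (X_pow_sub_C_splits_of_isPrimitiveRoot (hζ.map_of_injective
      (algebraMap k L).injective) (α := h) (a := algebraMap K L g) hg.symm).of_dvd
      (X_pow_sub_C_ne_zero (Nat.pos_of_ne_zero hn) _) ?_
    simpa using Polynomial.map_dvd (algebraMap K L) hdvd
  have hnodup : ((minpoly K h).aroots L).Nodup := nodup_roots hirr.separable.map
  obtain ⟨y, hy, hyh⟩ : ∃ y ∈ (minpoly K h).aroots L, y ≠ h := by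
    classical
    by_contra! H
    have hcard : ((minpoly K h).aroots L).card ≤ 1 :=
      (Multiset.count_eq_card.2 fun y hy ↦ (H y hy).symm) ▸
        Multiset.nodup_iff_count_le_one.1 hnodup h
    rw [← hsplit.natDegree_eq_card_roots, natDegree_map] at hcard
    have hd := minpoly.natDegree_pos hi
    exact hnot (minpoly.mem_range_of_degree_eq_one K h
      ((degree_eq_iff_natDegree_eq_of_pos one_pos).2 (by omega)))
  have hyroot : aeval y (minpoly K h) = 0 := (mem_aroots.1 hy).2
  have hmin : minpoly K h = minpoly K y :=
    minpoly.eq_of_irreducible_of_monic hirr hyroot (minpoly.monic hi)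
  have hyn : y ^ n = h ^ n := by
    obtain ⟨Q, hQ⟩ := hdvd
    have := congrArg (aeval y) hQ
    rw [map_mul, hyroot, zero_mul] at this
    simpa [hg, sub_eq_zero] using this
  obtain ⟨c, hc⟩ := mem_range_algebraMap_of_pow_eq_one (k := k) hn
    (x := y / h) (by rw [div_pow, hyn, div_self (pow_ne_zero _ h0)])
  have hc' : y = algebraMap k L c * h := by rw [hc]; field_simp
  have hc1 : c - 1 ≠ 0 := fun H ↦ hyh (by rw [hc', sub_eq_zero.1 H, map_one, one_mul])
  have hc0 : c ≠ 0 := by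
    rintro rfl
    rw [map_zero, zero_mul] at hc'
    rw [hc', zero_pow hn] at hyn
    exact pow_ne_zero n h0 hyn.symm
  have hnorm : Algebra.norm K (h - 1) = Algebra.norm K (y - 1) := by
    apply norm_eq_of_minpoly_eq
    have h1 := minpoly.sub_algebraMap (A := K) h 1
    have h2 := minpoly.sub_algebraMap (A := K) y 1
    rw [map_one] at h1 h2
    rw [h1, h2, hmin]
  -- the values at `w` of `h - 1` and of its conjugate `y - 1 = c (h - 1) + (c - 1)`
  have hw1 : w (h - 1) < 1 := by rwa [Valuation.map_sub_swap]
  have hw2 : w (y - 1) = 1 := by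
    have : y - 1 = algebraMap k L c * (h - 1) + algebraMap k L (c - 1) := by
      rw [hc', map_sub, map_one]; ring
    rw [this, Valuation.map_add_eq_of_lt_right _ ?_, hk _ hc1]
    rw [map_mul, hk _ hc0, hk _ hc1, one_mul]
    exact hw1
  rw [← hvw, hnorm, hvw, hw2] at hw1
  exact lt_irrefl _ hw1

end Kummer

/-! ### Constants, and pull-back of rational functions -/

namespace SmoothCurve

variable (C : SmoothCurve)

instance : Nonempty (⊤ : C.X.Opens) := ⟨⟨genericPoint C.X, trivial⟩⟩

theorem le_str_preimage_top (U : C.X.Opens) : U ≤ C.str ⁻¹ᵁ ⊤ := le_top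

/-- The constant functions on an open subset `U` of a curve. -/
def const (U : C.X.Opens) : ℂ →+* Γ(C.X, U) :=
  ((Scheme.ΓSpecIso (.of ℂ)).inv ≫ C.str.appLE ⊤ U (C.le_str_preimage_top U)).hom

theorem map_const {U V : C.X.Opens} (h : V ≤ U) (c : ℂ) :
    C.X.presheaf.map (homOfLE h).op (C.const U c) = C.const V c := by
  change ((Scheme.ΓSpecIso (.of ℂ)).inv ≫ C.str.appLE ⊤ U (C.le_str_preimage_top U) ≫
    C.X.presheaf.map (homOfLE h).op).hom c = _
  rw [Scheme.Hom.appLE_map]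
  rfl

/-- The constant functions, as elements of the function field. -/
def constFF : ℂ →+* C.X.functionField :=
  (C.X.germToFunctionField ⊤).hom.comp (C.const ⊤)

theorem germToFunctionField_const (U : C.X.Opens) [Nonempty U] (c : ℂ) :
    C.X.germToFunctionField U (C.const U c) = C.constFF c := by
  rw [← C.map_const (le_top : U ≤ ⊤)]
  exact C.X.presheaf.germ_res_apply (homOfLE le_top) (genericPoint C.X) _ _

variable {C}

theorem exists_affine_nhd (x : C.X) :
    ∃ U : C.X.Opens, IsAffineOpen U ∧ x ∈ U := by
  obtain ⟨_, ⟨U, hU, rfl⟩, hx, -⟩ := C.X.isBasis_affineOpens.exists_subset_of_mem_open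
    (Set.mem_univ x) isOpen_univ
  exact ⟨U, hU, hx⟩

variable {U : C.X.Opens} (hU : IsAffineOpen U)

include hU in
theorem finiteType_const : (C.const U).FiniteType := by
  have h1 := C.str.finiteType_appLE (isAffineOpen_top _) hU le_top
  exact h1.comp (RingHom.FiniteType.of_surjective _
    (Scheme.ΓSpecIso (.of ℂ)).symm.commRingCatIsoToRingEquiv.surjective)

include hU in
/-- By the Nullstellensatz, the residue fields at closed points are `ℂ`. -/
theorem exists_sub_const_mem (M : Ideal Γ(C.X, U)) [M.IsMaximal] (b : Γ(C.X, U)) :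
    ∃ c : ℂ, b - C.const U c ∈ M := by
  let := Ideal.Quotient.field M
  let := (C.const U).toAlgebra
  have : Algebra.FiniteType ℂ Γ(C.X, U) := finiteType_const hU
  have : Module.Finite ℂ (Γ(C.X, U) ⧸ M) := finite_of_finite_type_of_isJacobsonRing ℂ _
  have h1 : Function.Bijective (algebraMap ℂ (Γ(C.X, U) ⧸ M)) :=
    IsAlgClosed.algebraMap_bijective_of_isIntegral
  obtain ⟨c, hc⟩ := h1.2 (Ideal.Quotient.mk M b)
  exact ⟨c, Ideal.Quotient.eq.1 hc.symm⟩

theorem charZero_sections [Nonempty U] : CharZero Γ(C.X, U) :=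
  charZero_of_injective_ringHom (C.const U).injective

theorem charZero_functionField : CharZero C.X.functionField :=
  charZero_of_injective_ringHom C.constFF.injective

theorem exists_pt_mem (U : C.X.Opens) [Nonempty U] : ∃ q : ComplexPoint C.str, q.pt ∈ U := by
  obtain ⟨x, hx, hx'⟩ := nonempty_inter_closedPoints (Z := (U : Set C.X))
    (Set.nonempty_coe_sort.1 ‹_›) U.isOpen.isLocallyClosed
  obtain ⟨q, rfl⟩ := exists_pt_eq (s := C.str) hx'
  exact ⟨q, hx⟩

include hU in
theorem not_isField_sections [Nonempty U] : ¬ IsField Γ(C.X, U) := by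
  obtain ⟨q, hq⟩ := exists_pt_mem U
  exact Ring.not_isField_iff_exists_ideal_bot_lt_and_lt_top.2 ⟨(primeAt hU q hq).asIdeal,
    bot_lt_iff_ne_bot.2 (primeAt hU q hq).ne_bot,
    lt_top_iff_ne_top.2 (primeAt hU q hq).isPrime.ne_top⟩

end SmoothCurve

namespace Covering

open SmoothCurve

variable {C C₀ : SmoothCurve} (α : Covering C C₀)

theorem app_const (U : C₀.X.Opens) (c : ℂ) :
    α.hom.app U (C₀.const U c) = C.const (α.hom ⁻¹ᵁ U) c := by
  change ((Scheme.ΓSpecIso (.of ℂ)).inv ≫ C₀.str.appLE ⊤ U (C₀.le_str_preimage_top U) ≫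
      α.hom.app U).hom c =
    ((Scheme.ΓSpecIso (.of ℂ)).inv ≫ C.str.appLE ⊤ (α.hom ⁻¹ᵁ U) (C.le_str_preimage_top _)).hom c
  congr 3
  rw [Scheme.Hom.app_eq_appLE, Scheme.Hom.appLE_comp_appLE]
  simp only [α.hom_str]

/-- A finite morphism of curves is dominant: if the kernel of `α^*` were a maximal ideal, the
coordinate ring of `α⁻¹ U` would be integral over a field, hence a field. -/
theorem app_injective {U : C₀.X.Opens} (hU : IsAffineOpen U) [Nonempty (α.hom ⁻¹ᵁ U)] :
    Function.Injective (α.hom.app U).hom := by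
  have : Nonempty U := ‹Nonempty (α.hom ⁻¹ᵁ U)›.map fun x ↦ ⟨α.hom x.1, x.2⟩
  have hV := hU.preimage α.hom
  have := isDedekindDomain_sections hU
  rw [RingHom.injective_iff_ker_eq_bot]
  by_contra hne
  have hmax : (RingHom.ker (α.hom.app U).hom).IsMaximal :=
    (RingHom.ker_isPrime _).isMaximal hne
  apply not_isField_sections hV
  have hint : (α.hom.app U).hom.IsIntegral := (α.hom.finite_app U hU).to_isIntegral
  have hlift : (RingHom.kerLift (α.hom.app U).hom).IsIntegral :=
    RingHom.IsIntegral.tower_top (Ideal.Quotient.mk _) _ hint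
  let := (RingHom.kerLift (α.hom.app U).hom).toAlgebra
  have : Algebra.IsIntegral (Γ(C₀.X, U) ⧸ RingHom.ker (α.hom.app U).hom) Γ(C.X, α.hom ⁻¹ᵁ U) :=
    ⟨hlift⟩
  exact isField_of_isIntegral_of_isField'
    ((Ideal.Quotient.maximal_ideal_iff_isField_quotient _).1 hmax)

theorem hom_genericPoint : α.hom (genericPoint C.X) = genericPoint C₀.X := by
  obtain ⟨U, hU, hx⟩ := exists_affine_nhd (α.hom (genericPoint C.X))
  have hV := hU.preimage α.hom
  have hV' : Nonempty (α.hom ⁻¹ᵁ U) := ⟨⟨genericPoint C.X, hx⟩⟩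
  have : Nonempty U := ⟨⟨_, hx⟩⟩
  have h1 := IsAffineOpen.comap_primeIdealOf_appLE (f := α.hom) U hU _ hV le_rfl hx
  have h2 := hV.primeIdealOf_genericPoint
  have h3 := hU.primeIdealOf_genericPoint
  rw [genericPoint_eq_bot_of_affine] at h2 h3
  have h4 := α.app_injective hU
  have h5 : hU.primeIdealOf ⟨α.hom (genericPoint C.X), hx⟩ = ⊥ := by
    rw [← h1]
    apply PrimeSpectrum.ext
    rw [PrimeSpectrum.comap_asIdeal, h2, Scheme.Hom.appLE_eq_app]
    exact ((RingHom.injective_iff_ker_eq_bot _).1 h4)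
  have := congrArg hU.fromSpec (h5.trans h3.symm)
  rwa [hU.fromSpec_primeIdealOf, hU.fromSpec_primeIdealOf] at this

/-- The pull-back `α^*` of rational functions. -/
def pullbackFun : C₀.X.functionField →+* C.X.functionField :=
  (C₀.X.presheaf.stalkSpecializes (specializes_of_eq α.hom_genericPoint) ≫
    α.hom.stalkMap (genericPoint C.X)).hom

theorem nonempty_preimage (U : C₀.X.Opens) [h : Nonempty U] : Nonempty (α.hom ⁻¹ᵁ U) := by
  refine ⟨⟨genericPoint C.X, ?_⟩⟩
  change α.hom (genericPoint C.X) ∈ U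
  rw [α.hom_genericPoint]
  exact ((genericPoint_spec C₀.X).mem_open_set_iff U.isOpen).mpr (by simpa using h)

theorem pullbackFun_germ (U : C₀.X.Opens) [Nonempty U] [Nonempty (α.hom ⁻¹ᵁ U)]
    (a : Γ(C₀.X, U)) :
    α.pullbackFun (C₀.X.germToFunctionField U a) =
      C.X.germToFunctionField (α.hom ⁻¹ᵁ U) (α.hom.app U a) := by
  change (C₀.X.presheaf.germ U _ _ ≫ C₀.X.presheaf.stalkSpecializes _ ≫ α.hom.stalkMap _).hom a = _
  rw [TopCat.Presheaf.germ_stalkSpecializes_assoc, Scheme.Hom.germ_stalkMap]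
  rfl

theorem pullbackFun_constFF (c : ℂ) : α.pullbackFun (C₀.constFF c) = C.constFF c := by
  have := α.nonempty_preimage ⊤
  rw [← C₀.germToFunctionField_const ⊤, α.pullbackFun_germ, app_const, germToFunctionField_const]

end Covering

/-! ### Ramification, and divisors of pull-backs and norms -/

section Ramification

open IsDedekindDomain

/-- The length which defines `Covering.ramIdx` is the ramification index of the extension of
Dedekind domains. -/
theorem length_quotient_map_eq_ramificationIdx {A B S : Type*} [CommRing A] [IsDedekindDomain A]
    [CommRing B] [IsDedekindDomain B] [Algebra A B] [Module.IsTorsionFree A B]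
    (v : HeightOneSpectrum A) (w : HeightOneSpectrum B) [w.asIdeal.LiesOver v.asIdeal]
    [CommRing S] [IsDomain S] [IsDiscreteValuationRing S] [Algebra B S]
    [IsLocalization.AtPrime S w.asIdeal] :
    (Module.length S (S ⧸ (v.asIdeal.map (algebraMap A B)).map (algebraMap B S))).toNat =
      w.asIdeal.ramificationIdx A := by
  have hp : v.asIdeal.map (algebraMap A B) ≠ ⊥ := Ideal.map_ne_bot_of_ne_bot v.ne_bot
  obtain ⟨I, hqI, h⟩ := Ideal.eq_prime_pow_mul_coprime hp w.asIdeal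
  replace hqI : ¬ I ≤ w.asIdeal := by
    contrapose! hqI
    rw [sup_of_le_left hqI]
    exact w.isPrime.ne_top
  rw [← Ideal.IsDedekindDomain.ramificationIdx'_eq_normalizedFactors_count hp w.isPrime w.ne_bot,
    Ideal.ramificationIdx'_eq_ramificationIdx v.asIdeal w.asIdeal v.ne_bot] at h
  apply_fun Ideal.map (algebraMap B S) at h
  rw [Ideal.map_mul, Ideal.map_pow, IsLocalization.AtPrime.map_eq_top_of_not_le S hqI,
    Ideal.mul_top, IsLocalization.AtPrime.map_eq_maximalIdeal w.asIdeal S] at h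
  rw [h, IsDiscreteValuationRing.length_quotient_pow_maximalIdeal, ENat.toNat_natCast]

end Ramification

namespace Covering

open SmoothCurve IsDedekindDomain

variable {C C₀ : SmoothCurve} (α : Covering C C₀)

/-- The fibre of `α` over a complex point. -/
def fiber (p : ComplexPoint C₀.str) : Finset (ComplexPoint C.str) := (α.finite_fiber p).toFinset

theorem mem_fiber {p : ComplexPoint C₀.str} {q : ComplexPoint C.str} :
    q ∈ α.fiber p ↔ α.onPoints q = p := by
  simp [fiber]

/-- The coordinate ring of `α⁻¹ U` as an algebra over that of `U`. -/
@[reducible]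
def sectionsAlgebra (U : C₀.X.Opens) : Algebra Γ(C₀.X, U) Γ(C.X, α.hom ⁻¹ᵁ U) :=
  (α.hom.app U).hom.toAlgebra

/-- The function field of `C` as an extension of the function field of `C₀`, by means of `α^*`. -/
@[reducible]
def functionFieldAlgebra : Algebra C₀.X.functionField C.X.functionField :=
  α.pullbackFun.toAlgebra

/-- The function field of `C` as an algebra over the coordinate ring of `U ⊆ C₀`. -/
@[reducible]
def mixedAlgebra (U : C₀.X.Opens) [Nonempty U] : Algebra Γ(C₀.X, U) C.X.functionField :=
  (α.pullbackFun.comp (C₀.X.germToFunctionField U).hom).toAlgebra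

theorem isScalarTower_mixed (U : C₀.X.Opens) [Nonempty U] [Nonempty (α.hom ⁻¹ᵁ U)] :
    letI := α.sectionsAlgebra U
    letI := α.mixedAlgebra U
    IsScalarTower Γ(C₀.X, U) Γ(C.X, α.hom ⁻¹ᵁ U) C.X.functionField :=
  let := α.sectionsAlgebra U
  let := α.mixedAlgebra U
  .of_algebraMap_eq fun a ↦ α.pullbackFun_germ U a

section Chart

variable {U : C₀.X.Opens} (hU : IsAffineOpen U)

include hU in
theorem finite_sections :
    letI := α.sectionsAlgebra U
    Module.Finite Γ(C₀.X, U) Γ(C.X, α.hom ⁻¹ᵁ U) :=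
  α.hom.finite_app U hU

include hU in
theorem isTorsionFree_sections [Nonempty U] :
    letI := α.sectionsAlgebra U
    Module.IsTorsionFree Γ(C₀.X, U) Γ(C.X, α.hom ⁻¹ᵁ U) := by
  let := α.sectionsAlgebra U
  have := α.nonempty_preimage U
  rw [Module.isTorsionFree_iff_algebraMap_injective]
  exact α.app_injective hU

include hU in
theorem inertiaDeg_eq_one [Nonempty U] :
    letI := α.sectionsAlgebra U
    ∀ w : HeightOneSpectrum Γ(C.X, α.hom ⁻¹ᵁ U), w.asIdeal.inertiaDeg Γ(C₀.X, U) = 1 := by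
  let := α.sectionsAlgebra U
  have := α.nonempty_preimage U
  intro w
  have := α.finite_sections hU
  have := isDedekindDomain_sections (hU.preimage α.hom)
  rw [Ideal.inertiaDeg_eq_of_isMaximal (w.asIdeal.under Γ(C₀.X, U)) w.asIdeal]
  let := Ideal.Quotient.field (w.asIdeal.under Γ(C₀.X, U))
  apply finrank_eq_one 1 one_ne_zero
  intro x
  obtain ⟨b, rfl⟩ := Ideal.Quotient.mk_surjective x
  obtain ⟨c, hc⟩ := exists_sub_const_mem (hU.preimage α.hom) w.asIdeal b
  refine ⟨Ideal.Quotient.mk _ (C₀.const U c), ?_⟩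
  rw [Ideal.Quotient.eq.2 hc, ← α.app_const, Algebra.smul_def, mul_one]
  rfl

include hU in
theorem liesOver_primeAt_iff [Nonempty U] {p : ComplexPoint C₀.str} (hp : p.pt ∈ U)
    {q : ComplexPoint C.str} (hq : q.pt ∈ α.hom ⁻¹ᵁ U) :
    letI := α.sectionsAlgebra U
    (primeAt (hU.preimage α.hom) q hq).asIdeal.LiesOver (primeAt hU p hp).asIdeal ↔
      α.onPoints q = p := by
  let := α.sectionsAlgebra U
  have h1 := congrArg PrimeSpectrum.asIdeal
    (IsAffineOpen.comap_primeIdealOf_appLE (f := α.hom) U hU _ (hU.preimage α.hom) le_rfl hq)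
  rw [Scheme.Hom.appLE_eq_app] at h1
  have h2 : (primeAt (hU.preimage α.hom) q hq).asIdeal.under Γ(C₀.X, U) =
    (primeAt hU (α.onPoints q) hq).asIdeal := h1
  constructor
  · intro h
    exact primeAt_injective hU (HeightOneSpectrum.ext (h2.symm.trans h.over.symm))
  · rintro rfl
    exact ⟨h2.symm⟩

/-- The points of the fibre over `p ∈ U`, as primes of the coordinate ring of `α⁻¹ U`. -/
def fiberPrimes (p : ComplexPoint C₀.str) (hp : p.pt ∈ U) :
    α.fiber p ↪ HeightOneSpectrum Γ(C.X, α.hom ⁻¹ᵁ U) where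
  toFun q := primeAt (hU.preimage α.hom) q.1 (by
    change (α.onPoints q.1).pt ∈ U
    rwa [α.mem_fiber.1 q.2])
  inj' _ _ h := Subtype.ext (primeAt_injective _ h)

theorem mem_map_fiberPrimes_iff [Nonempty U] {p : ComplexPoint C₀.str} (hp : p.pt ∈ U)
    (w : HeightOneSpectrum Γ(C.X, α.hom ⁻¹ᵁ U)) :
    letI := α.sectionsAlgebra U
    w ∈ Finset.univ.map (α.fiberPrimes hU p hp) ↔ w.asIdeal.LiesOver (primeAt hU p hp).asIdeal := by
  have := α.nonempty_preimage U
  have := isDedekindDomain_sections (hU.preimage α.hom)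
  obtain ⟨q, hq, rfl⟩ := exists_primeAt_eq (hU.preimage α.hom) w w.isMaximal
  rw [α.liesOver_primeAt_iff hU hp hq, Finset.mem_map]
  constructor
  · rintro ⟨q', -, h⟩
    exact primeAt_injective _ h ▸ α.mem_fiber.1 q'.2
  · intro h
    exact ⟨⟨q, α.mem_fiber.2 h⟩, Finset.mem_univ _, rfl⟩

theorem ramIdx_eq_ramificationIdx [Nonempty U] {q : ComplexPoint C.str}
    (hq : q.pt ∈ α.hom ⁻¹ᵁ U) :
    letI := α.sectionsAlgebra U
    α.ramIdx q = (primeAt (hU.preimage α.hom) q hq).asIdeal.ramificationIdx Γ(C₀.X, U) := by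
  let := α.sectionsAlgebra U
  have := α.nonempty_preimage U
  have hV := hU.preimage α.hom
  have := isDedekindDomain_sections hU
  have := isDedekindDomain_sections hV
  have := α.isTorsionFree_sections hU
  have := (α.liesOver_primeAt_iff hU (p := α.onPoints q) (q := q) hq hq).2 rfl
  have := C.isDiscreteValuationRing_stalk (isClosed_pt q)
  let := C.X.presheaf.algebra_section_stalk (⟨q.pt, hq⟩ : (α.hom ⁻¹ᵁ U : C.X.Opens))
  have : IsLocalization.AtPrime (C.X.presheaf.stalk q.pt) (primeAt hV q hq).asIdeal :=
    hV.isLocalization_stalk ⟨q.pt, hq⟩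
  rw [← length_quotient_map_eq_ramificationIdx (S := C.X.presheaf.stalk q.pt)
    (primeAt hU (α.onPoints q) hq)]
  let := C₀.X.presheaf.algebra_section_stalk (⟨α.hom q.pt, hq⟩ : U)
  have : IsLocalization.AtPrime (C₀.X.presheaf.stalk (α.hom q.pt))
    (primeAt hU (α.onPoints q) hq).asIdeal := hU.isLocalization_stalk ⟨α.hom q.pt, hq⟩
  have h1 := IsLocalization.AtPrime.map_eq_maximalIdeal (primeAt hU (α.onPoints q) hq).asIdeal
    (C₀.X.presheaf.stalk (α.hom q.pt))
  have h2 : (α.hom.stalkMap q.pt).hom.comp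
      (algebraMap Γ(C₀.X, U) (C₀.X.presheaf.stalk (α.hom q.pt))) =
      (algebraMap Γ(C.X, α.hom ⁻¹ᵁ U) (C.X.presheaf.stalk q.pt)).comp
        (algebraMap Γ(C₀.X, U) Γ(C.X, α.hom ⁻¹ᵁ U)) := by
    ext a
    exact Scheme.Hom.germ_stalkMap_apply α.hom U q.pt hq a
  rw [ramIdx, ← h1, Ideal.map_map, h2, ← Ideal.map_map]

end Chart

theorem finiteDimensional_functionField :
    letI := α.functionFieldAlgebra
    FiniteDimensional C₀.X.functionField C.X.functionField := by
  let := α.functionFieldAlgebra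
  obtain ⟨q, -⟩ := exists_pt_mem (C := C₀) ⊤
  obtain ⟨U, hU, hq⟩ := exists_affine_nhd q.pt
  have : Nonempty U := ⟨⟨_, hq⟩⟩
  have := α.nonempty_preimage U
  let := α.sectionsAlgebra U
  let := α.mixedAlgebra U
  have := α.isScalarTower_mixed U
  have : IsScalarTower Γ(C₀.X, U) C₀.X.functionField C.X.functionField := .of_algebraMap_eq' rfl
  have := functionField_isFractionRing_of_isAffineOpen C₀.X U hU
  have := functionField_isFractionRing_of_isAffineOpen C.X _ (hU.preimage α.hom)
  have := α.isTorsionFree_sections hU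
  have := α.finite_sections hU
  exact Module.Finite.of_isLocalization Γ(C₀.X, U) Γ(C.X, α.hom ⁻¹ᵁ U)
    (nonZeroDivisors Γ(C₀.X, U))

/-- The norm `N_α` of rational functions. -/
def normFun : C.X.functionField →* C₀.X.functionField :=
  let := α.functionFieldAlgebra
  Algebra.norm C₀.X.functionField

/-- The degree `[ℂ(C) : ℂ(C₀)]` of the extension of function fields. -/
def fieldDegree : ℕ :=
  let := α.functionFieldAlgebra
  Module.finrank C₀.X.functionField C.X.functionField

theorem fieldDegree_pos : 0 < α.fieldDegree := by
  let := α.functionFieldAlgebra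
  have := α.finiteDimensional_functionField
  exact Module.finrank_pos

theorem ramIdx_pos (q : ComplexPoint C.str) : 0 < α.ramIdx q := by
  obtain ⟨U, hU, hp⟩ := exists_affine_nhd (α.onPoints q).pt
  have : Nonempty U := ⟨⟨_, hp⟩⟩
  let := α.sectionsAlgebra U
  have := α.finite_sections hU
  rw [α.ramIdx_eq_ramificationIdx hU (q := q) hp]
  exact Ideal.ramificationIdx_pos _ _

/-- `deg α^* p = [ℂ(C) : ℂ(C₀)]`. -/
theorem sum_ramIdx_fiber (p : ComplexPoint C₀.str) :
    ∑ q ∈ α.fiber p, α.ramIdx q = α.fieldDegree := by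
  obtain ⟨U, hU, hp⟩ := exists_affine_nhd p.pt
  have : Nonempty U := ⟨⟨_, hp⟩⟩
  have := α.nonempty_preimage U
  let := α.functionFieldAlgebra
  let := α.sectionsAlgebra U
  let := α.mixedAlgebra U
  have := α.isScalarTower_mixed U
  have : IsScalarTower Γ(C₀.X, U) C₀.X.functionField C.X.functionField := .of_algebraMap_eq' rfl
  have := functionField_isFractionRing_of_isAffineOpen C₀.X U hU
  have := functionField_isFractionRing_of_isAffineOpen C.X _ (hU.preimage α.hom)
  have := α.isTorsionFree_sections hU
  have := α.finite_sections hU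
  have := isDedekindDomain_sections hU
  have := isDedekindDomain_sections (hU.preimage α.hom)
  have h := sum_ramificationIdx_eq_finrank (α.mem_map_fiberPrimes_iff hU hp)
    fun w _ ↦ α.inertiaDeg_eq_one hU w
  rw [fieldDegree, IsFractionRing.finrank_eq Γ(C₀.X, U) _ Γ(C.X, α.hom ⁻¹ᵁ U), ← h,
    Finset.sum_map, ← Finset.sum_coe_sort]
  exact Finset.sum_congr rfl fun q _ ↦ α.ramIdx_eq_ramificationIdx hU _

theorem onPoints_surjective : Function.Surjective α.onPoints := by
  intro p
  have h : (α.fiber p).Nonempty := by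
    rw [Finset.nonempty_iff_ne_empty]
    intro h
    have := α.sum_ramIdx_fiber p
    rw [h, Finset.sum_empty] at this
    exact α.fieldDegree_pos.ne this
  exact h.imp fun q hq ↦ α.mem_fiber.1 hq

/-- `div (α^* f) = α^* (div f)`. -/
theorem ord_pullbackFun {f : C₀.X.functionField} (hf : f ≠ 0) (q : ComplexPoint C.str) :
    C.X.ord (α.pullbackFun f) q.pt = α.ramIdx q * C₀.X.ord f (α.onPoints q).pt := by
  obtain ⟨U, hU, hp⟩ := exists_affine_nhd (α.onPoints q).pt
  have hq : q.pt ∈ α.hom ⁻¹ᵁ U := hp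
  have : Nonempty U := ⟨⟨_, hp⟩⟩
  have := α.nonempty_preimage U
  let := α.functionFieldAlgebra
  let := α.sectionsAlgebra U
  let := α.mixedAlgebra U
  have := α.isScalarTower_mixed U
  have : IsScalarTower Γ(C₀.X, U) C₀.X.functionField C.X.functionField := .of_algebraMap_eq' rfl
  have := functionField_isFractionRing_of_isAffineOpen C₀.X U hU
  have := functionField_isFractionRing_of_isAffineOpen C.X _ (hU.preimage α.hom)
  have := α.isTorsionFree_sections hU
  have := α.finite_sections hU
  have := isDedekindDomain_sections hU
  have := isDedekindDomain_sections (hU.preimage α.hom)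
  have := (α.liesOver_primeAt_iff hU hp hq).2 rfl
  have h := valuation_algebraMap_eq_pow C₀.X.functionField C.X.functionField
    (primeAt hU (α.onPoints q) hp) (primeAt (hU.preimage α.hom) q hq) f
  have hf' : α.pullbackFun f ≠ 0 := (map_ne_zero _).2 hf
  change HeightOneSpectrum.valuation _ _ (α.pullbackFun f) = _ at h
  rw [valuation_eq_exp_neg_ord _ _ _ hf', valuation_eq_exp_neg_ord _ _ _ hf,
    ← α.ramIdx_eq_ramificationIdx hU, ← WithZero.exp_nsmul, WithZero.exp_inj] at h
  rw [nsmul_eq_mul] at h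
  linarith

/-- `div (N_α f)` is the push-forward of `div f`. -/
theorem ord_normFun {f : C.X.functionField} (hf : f ≠ 0) (p : ComplexPoint C₀.str) :
    C₀.X.ord (α.normFun f) p.pt = ∑ q ∈ α.fiber p, C.X.ord f q.pt := by
  obtain ⟨U, hU, hp⟩ := exists_affine_nhd p.pt
  have : Nonempty U := ⟨⟨_, hp⟩⟩
  have := α.nonempty_preimage U
  let := α.functionFieldAlgebra
  let := α.sectionsAlgebra U
  let := α.mixedAlgebra U
  have := α.isScalarTower_mixed U
  have : IsScalarTower Γ(C₀.X, U) C₀.X.functionField C.X.functionField := .of_algebraMap_eq' rfl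
  have := functionField_isFractionRing_of_isAffineOpen C₀.X U hU
  have := functionField_isFractionRing_of_isAffineOpen C.X _ (hU.preimage α.hom)
  have := α.isTorsionFree_sections hU
  have := α.finite_sections hU
  have := α.finiteDimensional_functionField
  have := isDedekindDomain_sections hU
  have := isDedekindDomain_sections (hU.preimage α.hom)
  have : CharZero Γ(C₀.X, U) := charZero_sections
  have hne : (Finset.univ.map (α.fiberPrimes hU p hp)).Nonempty := by
    obtain ⟨q, hq⟩ := α.onPoints_surjective p
    exact ⟨_, Finset.mem_map_of_mem _ (Finset.mem_univ ⟨q, α.mem_fiber.2 hq⟩)⟩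
  have h := valuation_norm C₀.X.functionField C.X.functionField
    (α.mem_map_fiberPrimes_iff hU hp) hne (α.inertiaDeg_eq_one hU) f
  have hf' : α.normFun f ≠ 0 := Algebra.norm_ne_zero_iff.2 hf
  change HeightOneSpectrum.valuation _ _ (α.normFun f) = _ at h
  rw [valuation_eq_exp_neg_ord _ _ _ hf', Finset.prod_map,
    Finset.prod_congr rfl fun q _ ↦ valuation_eq_exp_neg_ord _ q.1 _ hf, ← WithZero.exp_finsetSum,
    WithZero.exp_inj, Finset.sum_neg_distrib, neg_inj] at h
  rw [h]
  exact Finset.sum_coe_sort (α.fiber p) fun q ↦ C.X.ord f q.pt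

end Covering

/-! ### Rational functions without poles -/

namespace SmoothCurve

open IsDedekindDomain Opposite

variable {C : SmoothCurve}

theorem exists_germ_eq_of_ord_nonneg {f : C.X.functionField} (hf : f ≠ 0)
    (h : ∀ q : ComplexPoint C.str, 0 ≤ C.X.ord f q.pt) {U : C.X.Opens} (hU : IsAffineOpen U)
    [Nonempty U] : ∃ a, C.X.germToFunctionField U a = f := by
  have := isDedekindDomain_sections hU
  have := functionField_isFractionRing_of_isAffineOpen C.X U hU
  refine HeightOneSpectrum.mem_integers_of_valuation_le_one (R := Γ(C.X, U)) C.X.functionField f ?_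
  intro v
  obtain ⟨q, hq, rfl⟩ := exists_primeAt_eq hU v v.isMaximal
  rw [valuation_eq_exp_neg_ord hU q hq hf, ← WithZero.exp_zero, WithZero.exp_le_exp]
  linarith [h q]

/-- A rational function without poles is regular on every affine open subset, and these sections
glue. -/
theorem exists_globalSection_eq_of_ord_nonneg {f : C.X.functionField} (hf : f ≠ 0)
    (h : ∀ q : ComplexPoint C.str, 0 ≤ C.X.ord f q.pt) :
    ∃ a, C.X.germToFunctionField ⊤ a = f := by
  let ι := {U : C.X.Opens // IsAffineOpen U ∧ Nonempty U}
  have hne (i : ι) : Nonempty i.1 := i.2.2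
  choose s hs using fun i : ι ↦ exists_germ_eq_of_ord_nonneg hf h i.2.1
  have hcov : (⊤ : C.X.Opens) ≤ ⨆ i : ι, i.1 := by
    intro x _
    obtain ⟨U, hU, hx⟩ := exists_affine_nhd x
    exact TopologicalSpace.Opens.mem_iSup.2 ⟨⟨U, hU, ⟨⟨x, hx⟩⟩⟩, hx⟩
  have hgen (V : C.X.Opens) [Nonempty V] : genericPoint C.X ∈ V :=
    ((genericPoint_spec C.X).mem_open_set_iff V.isOpen).mpr (by simpa using ‹Nonempty V›)
  obtain ⟨a, ha, -⟩ := C.X.sheaf.existsUnique_gluing' (fun i : ι ↦ i.1) ⊤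
    (fun i ↦ homOfLE le_top) hcov s (by
      intro i j
      have hij : genericPoint C.X ∈ i.1 ⊓ j.1 := ⟨hgen i.1, hgen j.1⟩
      have : Nonempty (i.1 ⊓ j.1 : C.X.Opens) := ⟨⟨_, hij⟩⟩
      apply C.X.germToFunctionField_injective (i.1 ⊓ j.1)
      exact ((C.X.presheaf.germ_res_apply _ _ hij _).trans (hs i)).trans
        ((C.X.presheaf.germ_res_apply _ _ hij _).trans (hs j)).symm)
  obtain ⟨U, hU, hx⟩ := exists_affine_nhd (genericPoint C.X)
  let i : ι := ⟨U, hU, ⟨⟨_, hx⟩⟩⟩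
  refine ⟨a, ?_⟩
  rw [← hs i, ← ha i]
  exact (C.X.presheaf.germ_res_apply _ _ hx _).symm

/-- The global functions on a complete curve are constant. -/
theorem const_top_surjective : Function.Surjective (C.const ⊤) := by
  have h1 : (C.const ⊤).Finite := by
    have h := finite_appTop_of_universallyClosed ℂ C.str
    have h2 : C.str.appLE ⊤ ⊤ (C.le_str_preimage_top ⊤) = C.str.appTop :=
      (Scheme.Hom.app_eq_appLE _).symm
    rw [const, CommRingCat.hom_comp, h2]
    exact h.comp (RingHom.Finite.of_surjective _
      (Scheme.ΓSpecIso (.of ℂ)).symm.commRingCatIsoToRingEquiv.surjective)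
  let := (C.const ⊤).toAlgebra
  have : Module.Finite ℂ Γ(C.X, ⊤) := h1
  exact (IsAlgClosed.algebraMap_bijective_of_isIntegral (k := ℂ) (K := Γ(C.X, ⊤))).2

/-- A rational function without poles is constant. -/
theorem exists_constFF_eq {f : C.X.functionField} (hf : f ≠ 0)
    (h : ∀ q : ComplexPoint C.str, 0 ≤ C.X.ord f q.pt) : ∃ c : ℂ, C.constFF c = f := by
  obtain ⟨a, rfl⟩ := exists_globalSection_eq_of_ord_nonneg hf h
  obtain ⟨c, rfl⟩ := const_top_surjective a
  exact ⟨c, rfl⟩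

theorem ord_one (x : C.X) : C.X.ord (1 : C.X.functionField) x = 0 := by
  have h := Scheme.ord_mul (x := x) (one_ne_zero (α := C.X.functionField)) one_ne_zero
  rw [mul_one] at h
  omega

theorem ord_inv {f : C.X.functionField} (hf : f ≠ 0) (x : C.X) :
    C.X.ord f⁻¹ x = -C.X.ord f x := by
  have h := Scheme.ord_mul (x := x) hf (inv_ne_zero hf)
  rw [mul_inv_cancel₀ hf, ord_one] at h
  omega

theorem finite_ord_neg {f : C.X.functionField} (hf : f ≠ 0) :
    {q : ComplexPoint C.str | C.X.ord f q.pt < 0}.Finite := by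
  have : CompactSpace C.X := (quasiCompact_iff_compactSpace C.str).mp inferInstance
  obtain ⟨s, hs, h⟩ := isCompact_iff_finite_and_eq_biUnion_affineOpens.1
    (show IsCompact ((⊤ : C.X.Opens) : Set C.X) from isCompact_univ)
  refine (hs.biUnion (t := fun U ↦ {q | q.pt ∈ U.1 ∧ C.X.ord f q.pt < 0}) ?_).subset ?_
  · intro U _
    by_cases hne : Nonempty U.1
    · have := isDedekindDomain_sections U.2
      have := functionField_isFractionRing_of_isAffineOpen C.X _ U.2
      have h1 := HeightOneSpectrum.Support.finite Γ(C.X, U.1) f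
      rw [← Set.finite_coe_iff] at h1 ⊢
      refine Finite.of_injective (β := HeightOneSpectrum.Support Γ(C.X, U.1) f)
        (fun q ↦ ⟨primeAt U.2 q.1 q.2.1, ?_⟩) fun q q' hqq ↦
          Subtype.ext (primeAt_injective U.2 (congrArg Subtype.val hqq))
      change 1 < (primeAt U.2 q.1 q.2.1).valuation C.X.functionField f
      rw [valuation_eq_exp_neg_ord U.2 q.1 q.2.1 hf, ← WithZero.exp_zero, WithZero.exp_lt_exp]
      linarith [q.2.2]
    · convert Set.finite_empty
      ext q
      simp only [Set.mem_ofPred_eq, Set.mem_empty_iff_false, iff_false, not_and]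
      exact fun hq ↦ (hne ⟨⟨_, hq⟩⟩).elim
  · intro q hq
    have : q.pt ∈ (⊤ : C.X.Opens) := trivial
    rw [h] at this
    simp only [TopologicalSpace.Opens.mem_iSup] at this
    obtain ⟨U, hU, hqU⟩ := this
    exact Set.mem_biUnion hU ⟨hqU, hq⟩

theorem finite_support_ord {f : C.X.functionField} (hf : f ≠ 0) :
    (Function.support fun q : ComplexPoint C.str ↦ C.X.ord f q.pt).Finite := by
  refine ((finite_ord_neg hf).union (finite_ord_neg (inv_ne_zero hf))).subset fun q hq ↦ ?_
  simp only [Set.mem_union, Set.mem_ofPred_eq, ord_inv hf]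
  have : C.X.ord f q.pt ≠ 0 := hq
  omega

/-- The divisor of a nonzero rational function. -/
def divFun (f : C.X.functionField) (hf : f ≠ 0) : C.Div :=
  Finsupp.ofSupportFinite (fun q ↦ C.X.ord f q.pt) (finite_support_ord hf)

theorem divFun_apply {f : C.X.functionField} (hf : f ≠ 0) (q : ComplexPoint C.str) :
    divFun f hf q = C.X.ord f q.pt := rfl

theorem divFun_mem_principal {f : C.X.functionField} (hf : f ≠ 0) : divFun f hf ∈ C.principal :=
  ⟨f, hf, fun _ ↦ rfl⟩

end SmoothCurve

/-! ### Common zeros of polynomials -/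

section CommonZero

open MvPolynomial

/-- Fewer than `n` polynomials in `n` variables over an algebraically closed field which vanish at
the origin have another common zero: otherwise, after a translation, some maximal ideal of height
`n` would be minimal over an ideal with fewer than `n` generators. -/
theorem MvPolynomial.exists_ne_zero_eval_eq_zero {k ι J : Type*} [Field k] [IsAlgClosed k]
    [Finite ι] [Finite J] (hJ : Nat.card J < Nat.card ι) (f : J → MvPolynomial ι k)
    (hf : ∀ j, constantCoeff (f j) = 0) : ∃ x : ι → k, x ≠ 0 ∧ ∀ j, eval x (f j) = 0 := by
  by_contra! hcon
  obtain ⟨M, hM, hM'⟩ : ∃ M : Ideal (MvPolynomial ι k),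
      M.IsMaximal ∧ (Nat.card J : ℕ∞) < M.height := by
    by_contra! h
    have h1 : ringKrullDim (MvPolynomial ι k) ≤ (Nat.card J : ℕ∞) :=
      (ringKrullDim_le_iff_isMaximal_height_le _).2 fun M hM ↦ WithBot.coe_le_coe.2 (h M hM)
    rw [ringKrullDim_of_isNoetherianRing, ringKrullDim_eq_zero_of_field, zero_add] at h1
    have h2 : Nat.card ι ≤ Nat.card J := by exact_mod_cast h1
    omega
  obtain ⟨a, rfl⟩ := isMaximal_iff_eq_vanishingIdeal_singleton.1 hM
  let g (j : J) : MvPolynomial ι k := bind₁ (fun i ↦ X i - C (a i)) (f j)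
  have hg (j : J) (x : ι → k) : aeval x (g j) = eval (x - a) (f j) := by
    rw [aeval_bind₁, ← aeval_eq_eval]
    congr 2
    ext i
    simp
  have hz : zeroLocus k (Ideal.span (Set.range g)) = {a} := by
    ext x
    constructor
    · intro hx
      by_contra hne
      obtain ⟨j, hj⟩ := hcon (x - a) (sub_ne_zero.2 hne)
      rw [← hg] at hj
      exact hj (hx _ (Ideal.subset_span ⟨j, rfl⟩))
    · rintro rfl p hp
      have : Ideal.span (Set.range g) ≤ RingHom.ker (aeval x : MvPolynomial ι k →ₐ[k] k) := by
        rw [Ideal.span_le]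
        rintro _ ⟨j, rfl⟩
        change aeval x (g j) = 0
        rw [hg, sub_self, ← hf j, eval_zero]
      exact this hp
  have hrad := vanishingIdeal_zeroLocus_eq_radical (k := k) (K := k) (Ideal.span (Set.range g))
  rw [hz] at hrad
  have hmin : vanishingIdeal k {a} ∈ (Ideal.span (Set.range g)).minimalPrimes := by
    rw [hrad] at hM ⊢
    exact ⟨⟨hM.isPrime, Ideal.le_radical⟩, fun P hP _ ↦ hP.1.radical_le_iff.2 hP.2⟩
  have h1 := Ideal.height_le_card_of_mem_minimalPrimes_span (Set.finite_range g) hmin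
  have h2 : (Set.range g).ncard ≤ Nat.card J := by
    rw [← Set.image_univ, ← Set.ncard_univ]
    exact Set.ncard_image_le Set.finite_univ
  exact absurd (hM'.trans_le h1) (by exact_mod_cast h2.not_gt)

end CommonZero

section Tsen

open Polynomial in
/-- The **Tsen–Lang theorem** for systems of polynomials over `k[t]`: the unknowns are taken to be
polynomials in `t` of large degree, and their coefficients are found by
`MvPolynomial.exists_ne_zero_eval_eq_zero`. -/
theorem MvPolynomial.exists_ne_zero_eval_eq_zero_polynomial {k ι J : Type*} [Field k]
    [IsAlgClosed k] [Finite ι] [Finite J] (d : ℕ) (hd : Nat.card J * d < Nat.card ι)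
    (f : J → MvPolynomial ι k[X]) (hf : ∀ j, constantCoeff (f j) = 0)
    (hdeg : ∀ j, (f j).totalDegree ≤ d) :
    ∃ x : ι → k[X], x ≠ 0 ∧ ∀ j, eval x (f j) = 0 := by
  classical
  cases nonempty_fintype ι
  cases nonempty_fintype J
  -- a common bound for the degrees of the coefficients
  obtain ⟨c, hc⟩ : ∃ c : ℕ, ∀ j m, ((f j).coeff m).natDegree ≤ c := by
    refine ⟨∑ j, ∑ m ∈ (f j).support, ((f j).coeff m).natDegree, fun j m ↦ ?_⟩
    by_cases hm : m ∈ (f j).support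
    · exact (Finset.single_le_sum (f := fun m ↦ ((f j).coeff m).natDegree)
        (fun _ _ ↦ Nat.zero_le _) hm).trans
        (Finset.single_le_sum (f := fun j ↦ ∑ m ∈ (f j).support, ((f j).coeff m).natDegree)
          (fun _ _ ↦ Nat.zero_le _) (Finset.mem_univ j))
    · simp [MvPolynomial.notMem_support_iff.1 hm]
  -- the degree `s` of the unknowns is so large that there are more coefficients than conditions
  let s := Nat.card J * (c + 1)
  let σ := ι × Fin (s + 1)
  let y (i : ι) : (MvPolynomial σ k)[X] :=
    ∑ l : Fin (s + 1), Polynomial.C (MvPolynomial.X (i, l)) * Polynomial.X ^ (l : ℕ)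
  let Φ : MvPolynomial ι k[X] →+* (MvPolynomial σ k)[X] :=
    eval₂Hom (Polynomial.mapRingHom MvPolynomial.C) y
  have hy (i : ι) : (y i).natDegree ≤ s :=
    Polynomial.natDegree_sum_le_of_forall_le _ _ fun l _ ↦
      (Polynomial.natDegree_C_mul_X_pow_le _ _).trans (Nat.lt_succ_iff.1 l.2)
  have hΦdeg (j : J) : (Φ (f j)).natDegree ≤ c + d * s := by
    rw [show Φ (f j) = eval₂ _ y (f j) from rfl, eval₂_eq]
    refine Polynomial.natDegree_sum_le_of_forall_le _ _ fun m hm ↦ ?_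
    refine Polynomial.natDegree_mul_le.trans (add_le_add ?_ ?_)
    · exact (Polynomial.natDegree_map_le).trans (hc j m)
    · refine (Polynomial.natDegree_prod_le _ _).trans ?_
      calc ∑ i ∈ m.support, (y i ^ m i).natDegree ≤ ∑ i ∈ m.support, m i * s :=
            Finset.sum_le_sum fun i _ ↦ Polynomial.natDegree_pow_le.trans
              (Nat.mul_le_mul_left _ (hy i))
        _ = (∑ i ∈ m.support, m i) * s := (Finset.sum_mul ..).symm
        _ ≤ d * s := Nat.mul_le_mul_right _ ((le_totalDegree hm).trans (hdeg j))
  let x (z : σ → k) (i : ι) : k[X] :=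
    ∑ l : Fin (s + 1), Polynomial.C (z (i, l)) * Polynomial.X ^ (l : ℕ)
  have hΦ (z : σ → k) (p : MvPolynomial ι k[X]) :
      (Φ p).map (MvPolynomial.eval z) = eval (x z) p := by
    change ((Polynomial.mapRingHom (MvPolynomial.eval z)).comp Φ) p = _
    congr 1
    refine MvPolynomial.ringHom_ext (fun a ↦ ?_) fun i ↦ ?_
    · have : (MvPolynomial.eval z).comp (MvPolynomial.C : k →+* MvPolynomial σ k) =
        RingHom.id k := by ext; simp
      simp [Φ, this]
    · simp [Φ, x, y]
  obtain ⟨z, hz, h⟩ := MvPolynomial.exists_ne_zero_eval_eq_zero (k := k) (ι := σ)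
    (J := J × Fin (c + d * s + 1)) (by
      simp only [Nat.card_prod, Nat.card_fin, σ]
      have h2 : s = Nat.card J * (c + 1) := rfl
      nlinarith)
    (fun je ↦ (Φ (f je.1)).coeff je.2) fun je ↦ by
      rw [← MvPolynomial.eval_zero, ← Polynomial.coeff_map, hΦ]
      have : x 0 = 0 := by ext1 i; simp [x]
      rw [this, eval_zero, hf, Polynomial.coeff_zero]
  refine ⟨x z, fun hx ↦ hz ?_, fun j ↦ ?_⟩
  · ext ⟨i, l⟩
    have h1 := congrArg (fun p : k[X] ↦ p.coeff l) (congrFun hx i)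
    simpa [x, Polynomial.finsetSum_coeff, Polynomial.coeff_X_pow, Fin.val_inj] using h1
  · rw [← hΦ]
    ext e
    rw [Polynomial.coeff_map, Polynomial.coeff_zero]
    by_cases he : e < c + d * s + 1
    · exact h (j, ⟨e, he⟩)
    · rw [Polynomial.coeff_eq_zero_of_natDegree_lt, map_zero]
      have := hΦdeg j
      omega

end Tsen

/-! ### Function fields of curves as `C₁`-fields -/

section Tsen

open MvPolynomial

theorem MvPolynomial.totalDegree_bind₁_le {ι τ R : Type*} [CommRing R] {g : ι → MvPolynomial τ R}
    (hg : ∀ i, (g i).totalDegree ≤ 1) (p : MvPolynomial ι R) :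
    (bind₁ g p).totalDegree ≤ p.totalDegree := by
  rw [bind₁, aeval_def, eval₂_eq]
  refine totalDegree_finsetSum_le fun m hm ↦ (totalDegree_mul _ _).trans ?_
  rw [algebraMap_eq, totalDegree_C, zero_add]
  refine ((totalDegree_finsetProd _ _).trans (Finset.sum_le_sum fun i _ ↦ ?_)).trans
    (le_totalDegree hm)
  exact (totalDegree_pow _ _).trans ((Nat.mul_le_mul_left _ (hg i)).trans (mul_one _).le)

open Polynomial in
/-- Restriction of scalars from a finite extension of `k[t]` to `k[t]` reduces a polynomial of
degree `d` in more than `d` variables to a system covered by the Tsen–Lang theorem. -/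
theorem MvPolynomial.exists_ne_zero_eval_eq_zero_of_finite {k A ι : Type*} [Field k]
    [IsAlgClosed k] [CommRing A] [IsDomain A] [Algebra k[X] A] [Module.Finite k[X] A]
    [Module.IsTorsionFree k[X] A] [Finite ι] (P : MvPolynomial ι A) (hP : constantCoeff P = 0)
    (hdeg : P.totalDegree < Nat.card ι) : ∃ x : ι → A, x ≠ 0 ∧ eval x P = 0 := by
  classical
  let b := Module.Free.chooseBasis k[X] A
  let J := Module.Free.ChooseBasisIndex k[X] A
  let Q : MvPolynomial (ι × J) A :=
    bind₁ (fun i ↦ ∑ j, MvPolynomial.C (b j) * MvPolynomial.X (i, j)) P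
  have hQdeg : Q.totalDegree ≤ P.totalDegree := by
    refine totalDegree_bind₁_le (fun i ↦ totalDegree_finsetSum_le fun j _ ↦ ?_) P
    refine (totalDegree_mul _ _).trans ?_
    rw [totalDegree_C, totalDegree_X]
  have hQ (y : ι × J → A) : eval y Q = eval (fun i ↦ ∑ j, b j * y (i, j)) P := by
    rw [← aeval_eq_eval, ← aeval_eq_eval]
    change aeval y (bind₁ _ P) = _
    rw [aeval_bind₁]
    congr 2
    ext i
    simp
  have hQ0 : coeff 0 Q = 0 := by
    rw [← constantCoeff_eq, ← eval_zero, hQ]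
    convert hP
    rw [← eval_zero]
    congr 2
    ext i
    simp
  let f (j : J) : MvPolynomial (ι × J) k[X] :=
    ∑ m ∈ Q.support, monomial m (b.repr (Q.coeff m) j)
  obtain ⟨y, hy, h⟩ := exists_ne_zero_eval_eq_zero_polynomial (k := k) (ι := ι × J) (J := J)
    P.totalDegree (by
      rw [Nat.card_prod, mul_comm]
      exact Nat.mul_lt_mul_of_pos_right hdeg Nat.card_pos) f
    (fun j ↦ by
      rw [map_sum]
      refine Finset.sum_eq_zero fun m _ ↦ ?_
      rw [constantCoeff_monomial]
      split_ifs with hm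
      · rw [hm, hQ0, map_zero, Finsupp.zero_apply]
      · rfl)
    fun j ↦ totalDegree_finsetSum_le fun m hm ↦
      ((totalDegree_monomial_le _ _).trans (le_totalDegree hm)).trans hQdeg
  refine ⟨fun i ↦ ∑ j, y (i, j) • b j, fun hx ↦ hy ?_, ?_⟩
  · ext1 ⟨i, j⟩
    have := congrArg (fun a ↦ b.repr a j) (congrFun hx i)
    simpa [Finsupp.single_apply] using this
  · have h1 : eval (fun ij ↦ algebraMap k[X] A (y ij)) Q = 0 := by
      apply b.repr.injective
      ext1 j
      rw [map_zero, Finsupp.zero_apply, ← h j, eval_eq, map_sum, Finsupp.finsetSum_apply, map_sum]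
      refine Finset.sum_congr rfl fun m _ ↦ ?_
      rw [eval_monomial, mul_comm]
      simp_rw [← map_pow]
      rw [← map_prod, ← Algebra.smul_def, map_smul, Finsupp.smul_apply, smul_eq_mul, mul_comm]
      rfl
    rw [hQ] at h1
    convert h1 using 4 with i
    refine Finset.sum_congr rfl fun j _ ↦ ?_
    rw [Algebra.smul_def, mul_comm]

open Polynomial in
/-- The previous result for the field of fractions, which is thus a `C₁`-field. -/
theorem MvPolynomial.exists_ne_zero_eval_eq_zero_of_isFractionRing {k A K ι : Type*} [Field k]
    [IsAlgClosed k] [CommRing A] [IsDomain A] [Algebra k[X] A] [Module.Finite k[X] A]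
    [Module.IsTorsionFree k[X] A] [Field K] [Algebra A K] [IsFractionRing A K]
    [Finite ι] (P : MvPolynomial ι K) (hP : constantCoeff P = 0)
    (hdeg : P.totalDegree < Nat.card ι) : ∃ x : ι → K, x ≠ 0 ∧ eval x P = 0 := by
  classical
  obtain ⟨a, ha⟩ := IsLocalization.exist_integer_multiples (nonZeroDivisors A) P.support P.coeff
  choose! c hc using ha
  have ha0 : algebraMap A K a ≠ 0 := by
    simp
  let Q : MvPolynomial ι A := ∑ m ∈ P.support, monomial m (c m)
  have hQ : MvPolynomial.map (algebraMap A K) Q = MvPolynomial.C (algebraMap A K a) * P := by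
    conv_rhs => rw [P.as_sum, Finset.mul_sum]
    rw [map_sum]
    refine Finset.sum_congr rfl fun m hm ↦ ?_
    rw [map_monomial, hc m hm, C_mul_monomial, Algebra.smul_def]
  obtain ⟨x, hx, h⟩ := exists_ne_zero_eval_eq_zero_of_finite (k := k) Q (by
      apply IsFractionRing.injective A K
      rw [← constantCoeff_map, hQ, map_mul, hP, mul_zero, map_zero])
    ((totalDegree_finsetSum_le fun m hm ↦
      (totalDegree_monomial_le _ _).trans (le_totalDegree hm)).trans_lt hdeg)
  refine ⟨algebraMap A K ∘ x, fun h0 ↦ hx ?_, ?_⟩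
  · ext1 i
    apply IsFractionRing.injective A K
    rw [Pi.zero_apply, map_zero]
    exact congrFun h0 i
  · have h1 := congrArg (eval (algebraMap A K ∘ x)) hQ
    rw [← map_eval, h, map_zero, map_mul, eval_C] at h1
    exact (mul_eq_zero.1 h1.symm).resolve_left ha0

/-- In a finite extension `L` of a `C₁`-field `K`, every element of `K` is a norm. -/
theorem Algebra.exists_norm_eq {K L : Type*} [Field K] [Field L] [Algebra K L]
    [FiniteDimensional K L]
    (hK : ∀ (n : ℕ) (P : MvPolynomial (Fin n) K), constantCoeff P = 0 → P.totalDegree < n →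
      ∃ x : Fin n → K, x ≠ 0 ∧ eval x P = 0) {g : K} :
    ∃ f : L, Algebra.norm K f = g := by
  classical
  let r := Module.finrank K L
  have hr : r ≠ 0 := Module.finrank_pos.ne'
  let b := Module.finBasis K L
  let P : MvPolynomial (Fin (r + 1)) K :=
    Matrix.det (∑ i, (MvPolynomial.X (Fin.succ i) : MvPolynomial (Fin (r + 1)) K) •
      (Algebra.leftMulMatrix b (b i)).map (MvPolynomial.C (σ := Fin (r + 1)))) -
    MvPolynomial.C g * MvPolynomial.X 0 ^ r
  have hP (x : Fin (r + 1) → K) :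
      eval x P = Algebra.norm K (∑ i, x (Fin.succ i) • b i) - g * x 0 ^ r := by
    rw [map_sub, map_mul, map_pow, eval_C, eval_X, RingHom.map_det, Algebra.norm_eq_matrix_det b]
    congr 2
    rw [map_sum, map_sum]
    refine Finset.sum_congr rfl fun i _ ↦ ?_
    ext j l
    simp
  obtain ⟨x, hx, h⟩ := hK (r + 1) P (by
    rw [← eval_zero, hP]
    simp [hr]) (Nat.lt_succ_of_le (by
      refine (totalDegree_sub _ _).trans (max_le ?_ ?_)
      · rw [Matrix.det_apply]
        refine totalDegree_finsetSum_le fun σ _ ↦ ?_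
        refine (totalDegree_smul_le _ _).trans ((totalDegree_finsetProd _ _).trans ?_)
        refine (Finset.sum_le_card_nsmul _ _ 1 fun j _ ↦ ?_).trans (by simp [r])
        rw [Matrix.sum_apply]
        refine totalDegree_finsetSum_le fun i _ ↦ ?_
        rw [Matrix.smul_apply, Matrix.map_apply, smul_eq_mul]
        refine (totalDegree_mul _ _).trans ?_
        rw [totalDegree_C, totalDegree_X]
      · refine (totalDegree_mul _ _).trans ?_
        rw [totalDegree_C, totalDegree_X_pow, zero_add]))
  rw [hP, sub_eq_zero] at h
  have h0 : x 0 ≠ 0 := by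
    intro h0
    rw [h0, zero_pow hr, mul_zero, Algebra.norm_eq_zero_iff] at h
    have h2 := (Fintype.linearIndependent_iff.1 b.linearIndependent) _ h
    apply hx
    ext i
    induction i using Fin.cases with
    | zero => exact h0
    | succ i => exact h2 i
  refine ⟨algebraMap K L (x 0)⁻¹ * ∑ i, x (Fin.succ i) • b i, ?_⟩
  rw [map_mul, Algebra.norm_algebraMap, h, inv_pow, mul_comm g,
    inv_mul_cancel_left₀ (pow_ne_zero _ h0)]

open Polynomial in
/-- Noether normalization in dimension one. -/
theorem exists_polynomial_finite {k A : Type*} [Field k] [CommRing A] [IsDomain A] [Algebra k A]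
    [Algebra.FiniteType k A] [Ring.DimensionLEOne A] (hA : ¬ IsField A) :
    ∃ g : k[X] →ₐ[k] A, Function.Injective g ∧ g.Finite := by
  obtain ⟨s, g, hg, hfin⟩ := exists_finite_inj_algHom_of_fg k A
  have hint : g.toRingHom.IsIntegral := hfin.to_isIntegral
  algebraize [g.toRingHom]
  have hs : s = 1 := by
    have h1 : Ring.DimensionLEOne (MvPolynomial (Fin s) k) := ⟨fun {p} hp hpp ↦ by
      obtain ⟨Q, hQ, hQp⟩ := Ideal.exists_ideal_over_prime_of_isIntegral_of_isDomain (S := A) p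
        (((RingHom.injective_iff_ker_eq_bot (algebraMap (MvPolynomial (Fin s) k) A)).1 hg).trans_le
          bot_le)
      have : Q.IsMaximal := hQ.isMaximal (by
        rintro rfl
        apply hp
        rw [← hQp, eq_bot_iff]
        exact ((RingHom.injective_iff_ker_eq_bot _).1 hg).le)
      rw [← hQp]
      exact Ideal.isMaximal_comap_of_isIntegral_of_isMaximal Q⟩
    have h2 : ringKrullDim (MvPolynomial (Fin s) k) ≤ 1 :=
      Ring.krullDimLE_iff.1 (inferInstance : Ring.KrullDimLE 1 (MvPolynomial (Fin s) k))
    rw [MvPolynomial.ringKrullDim_of_isNoetherianRing, ringKrullDim_eq_zero_of_field,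
      zero_add] at h2
    have h3 : s ≤ 1 := by simpa using h2
    by_contra hs
    obtain rfl : s = 0 := by omega
    refine hA (isField_of_isIntegral_of_isField' (R := MvPolynomial (Fin 0) k) ?_)
    exact (MvPolynomial.isEmptyAlgEquiv k (Fin 0)).toMulEquiv.isField (Field.toIsField k)
  subst hs
  let e := (MvPolynomial.uniqueAlgEquiv k (Fin 1)).symm
  exact ⟨g.comp e.toAlgHom, hg.comp e.injective,
    RingHom.Finite.comp hfin (RingHom.Finite.of_surjective _ e.surjective)⟩

end Tsen

/-! ### Norms of rational functions, and the homomorphisms of Jacobians -/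

namespace Covering

open SmoothCurve IsDedekindDomain

variable {C C₀ : SmoothCurve} (α : Covering C C₀)

/-- **Tsen's theorem**: every rational function on `C₀` is the norm of one on `C`. -/
theorem normFun_surjective : Function.Surjective α.normFun := by
  intro g
  let := α.functionFieldAlgebra
  have := α.finiteDimensional_functionField
  refine Algebra.exists_norm_eq (K := C₀.X.functionField) (L := C.X.functionField)
    (fun n P hP hdeg ↦ ?_)
  obtain ⟨q, -⟩ := exists_pt_mem (C := C₀) ⊤
  obtain ⟨U, hU, hq⟩ := exists_affine_nhd q.pt
  have : Nonempty U := ⟨⟨_, hq⟩⟩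
  have := isDedekindDomain_sections hU
  have := functionField_isFractionRing_of_isAffineOpen C₀.X U hU
  let := (C₀.const U).toAlgebra
  have : Algebra.FiniteType ℂ Γ(C₀.X, U) := finiteType_const hU
  obtain ⟨φ, hφ, hfin⟩ := exists_polynomial_finite (k := ℂ) (not_isField_sections hU)
  let := φ.toRingHom.toAlgebra
  have : Module.Finite (Polynomial ℂ) Γ(C₀.X, U) := hfin
  have : Module.IsTorsionFree (Polynomial ℂ) Γ(C₀.X, U) :=
    Module.isTorsionFree_iff_algebraMap_injective.2 hφ
  exact MvPolynomial.exists_ne_zero_eval_eq_zero_of_isFractionRing (k := ℂ) (A := Γ(C₀.X, U)) P hP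
    (by rwa [Nat.card_fin])

theorem normDiv_apply (D : C.Div) (p : ComplexPoint C₀.str) :
    α.normDiv D p = ∑ q ∈ α.fiber p, D q := by
  classical
  change Finsupp.mapDomain α.onPoints D p = _
  induction D using Finsupp.induction_linear with
  | zero => simp
  | add D E hD hE => simp [Finsupp.mapDomain_add, hD, hE, Finset.sum_add_distrib]
  | single q n =>
    rw [Finsupp.mapDomain_single, Finsupp.single_apply]
    simp [Finsupp.single_apply, mem_fiber]

theorem normDiv_divFun {f : C.X.functionField} (hf : f ≠ 0) (p : ComplexPoint C₀.str) :
    α.normDiv (divFun f hf) p = C₀.X.ord (α.normFun f) p.pt := by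
  rw [normDiv_apply, ord_normFun α hf]
  rfl

theorem normFun_ne_zero {f : C.X.functionField} (hf : f ≠ 0) : α.normFun f ≠ 0 := by
  let := α.functionFieldAlgebra
  have := α.finiteDimensional_functionField
  exact Algebra.norm_ne_zero_iff.2 hf

theorem normDiv_mem_principal {D : C.Div} (hD : D ∈ C.principal) : α.normDiv D ∈ C₀.principal := by
  obtain ⟨f, hf, h⟩ := hD
  obtain rfl : D = divFun f hf := Finsupp.ext h
  exact ⟨α.normFun f, α.normFun_ne_zero hf, α.normDiv_divFun hf⟩

theorem deg_normDiv (D : C.Div) : C₀.deg (α.normDiv D) = C.deg D := by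
  induction D using Finsupp.induction_linear with
  | zero => simp
  | add D E hD hE => simp [hD, hE]
  | single q n =>
    change C₀.deg (Finsupp.mapDomain _ _) = _
    simp [deg, Finsupp.mapDomain_single]

theorem pullbackDiv_apply (D : C₀.Div) (q : ComplexPoint C.str) :
    α.pullbackDiv D q = α.ramIdx q * D (α.onPoints q) := rfl

/-- The pull-back of divisors as a homomorphism. -/
def pullbackDivHom : C₀.Div →+ C.Div where
  toFun := α.pullbackDiv
  map_zero' := by ext q; simp [pullbackDiv_apply]
  map_add' D E := by ext q; simp [pullbackDiv_apply, mul_add]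

theorem normDiv_pullbackDiv (D : C₀.Div) : α.normDiv (α.pullbackDiv D) = α.fieldDegree • D := by
  ext p
  rw [normDiv_apply, Finsupp.smul_apply, ← α.sum_ramIdx_fiber p, nsmul_eq_mul, Nat.cast_sum,
    Finset.sum_mul]
  refine Finset.sum_congr rfl fun q hq ↦ ?_
  rw [pullbackDiv_apply, α.mem_fiber.1 hq]

theorem deg_pullbackDiv (D : C₀.Div) : C.deg (α.pullbackDiv D) = α.fieldDegree • C₀.deg D := by
  rw [← deg_normDiv, normDiv_pullbackDiv, map_nsmul]

theorem pullbackDiv_mem_principal {D : C₀.Div} (hD : D ∈ C₀.principal) :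
    α.pullbackDiv D ∈ C.principal := by
  obtain ⟨f, hf, h⟩ := hD
  refine ⟨α.pullbackFun f, (map_ne_zero _).2 hf, fun q ↦ ?_⟩
  rw [pullbackDiv_apply, h, ord_pullbackFun α hf]

end Covering

namespace SmoothCurve

variable {C C₀ : SmoothCurve}

/-- A homomorphism of divisor groups which preserves principal divisors and divisors of degree `0`
induces a homomorphism of Jacobians. -/
def jacMap (F : C.Div →+ C₀.Div) (hF : ∀ D ∈ C.principal, F D ∈ C₀.principal)
    (hdeg : ∀ D, C.deg D = 0 → C₀.deg (F D) = 0) : C.Jac →+ C₀.Jac :=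
  AddMonoidHom.codRestrict
    ((QuotientAddGroup.map C.principal C₀.principal F hF).comp Jac.toPic) C₀.pic0 (by
      rintro ⟨_, D, hD, rfl⟩
      exact ⟨F D, hdeg D hD, rfl⟩)

theorem exists_toJac_eq (x : C.Jac) : ∃ (D : C.Div) (hD : C.deg D = 0), C.toJac D hD = x := by
  obtain ⟨_, D, hD, rfl⟩ := x
  exact ⟨D, hD, rfl⟩

theorem toPic_injective : Function.Injective (Jac.toPic : C.Jac →+ C.Pic) :=
  C.pic0.subtype_injective

theorem cls_eq_zero_iff {D : C.Div} : C.cls D = 0 ↔ D ∈ C.principal :=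
  QuotientAddGroup.eq_zero_iff D

theorem toJac_eq_zero_iff {D : C.Div} (hD : C.deg D = 0) : C.toJac D hD = 0 ↔ D ∈ C.principal := by
  rw [← cls_eq_zero_iff, ← toPic_injective.eq_iff, map_zero]
  rfl

theorem toJac_eq_iff {D E : C.Div} (hD : C.deg D = 0) (hE : C.deg E = 0) :
    C.toJac D hD = C.toJac E hE ↔ D - E ∈ C.principal := by
  rw [← cls_eq_zero_iff, map_sub, sub_eq_zero, ← toPic_injective.eq_iff]
  rfl

end SmoothCurve

namespace Covering

open SmoothCurve

variable {C C₀ : SmoothCurve} (α : Covering C C₀)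

/-- The pull-back homomorphism of Jacobians. -/
def pullbackJac : C₀.Jac →+ C.Jac :=
  jacMap α.pullbackDivHom (fun _ h ↦ α.pullbackDiv_mem_principal h) fun D hD ↦ by
    change C.deg (α.pullbackDiv D) = 0
    rw [deg_pullbackDiv, hD, smul_zero]

theorem isPullbackHom_pullbackJac : α.IsPullbackHom α.pullbackJac := fun _ _ ↦ rfl

/-- The norm homomorphism of Jacobians. -/
def normJac : C.Jac →+ C₀.Jac :=
  jacMap α.normDiv (fun _ h ↦ α.normDiv_mem_principal h) fun D hD ↦ by rw [deg_normDiv, hD]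

theorem isNormHom_normJac : α.IsNormHom α.normJac := fun _ _ ↦ rfl

theorem pullbackJac_toJac_eq_zero_iff {D : C₀.Div} (hD : C₀.deg D = 0) :
    α.pullbackJac (C₀.toJac D hD) = 0 ↔ α.pullbackDiv D ∈ C.principal := by
  rw [← cls_eq_zero_iff, ← toPic_injective.eq_iff, map_zero]
  rfl

theorem normJac_toJac_eq_zero_iff {D : C.Div} (hD : C.deg D = 0) :
    α.normJac (C.toJac D hD) = 0 ↔ α.normDiv D ∈ C₀.principal := by
  rw [← cls_eq_zero_iff, ← toPic_injective.eq_iff, map_zero]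
  rfl

end Covering

/-! ### Injectivity of the pull-back -/

namespace SmoothCurve

open IsDedekindDomain

variable {C : SmoothCurve}

theorem ord_pow {f : C.X.functionField} (hf : f ≠ 0) (n : ℕ) (x : C.X) :
    C.X.ord (f ^ n) x = n * C.X.ord f x := by
  induction n with
  | zero => simp [ord_one]
  | succ n ih =>
    rw [pow_succ, Scheme.ord_mul (pow_ne_zero n hf) hf, ih]
    push_cast
    ring

theorem exists_ord_eq_one (p : ComplexPoint C.str) :
    ∃ t : C.X.functionField, t ≠ 0 ∧ C.X.ord t p.pt = 1 := by
  obtain ⟨U, hU, hp⟩ := exists_affine_nhd p.pt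
  have : Nonempty U := ⟨⟨_, hp⟩⟩
  have := isDedekindDomain_sections hU
  have := functionField_isFractionRing_of_isAffineOpen C.X U hU
  obtain ⟨t, ht⟩ := (primeAt hU p hp).valuation_exists_uniformizer C.X.functionField
  have ht0 : t ≠ 0 := by
    rintro rfl
    rw [map_zero] at ht
    exact WithZero.exp_ne_zero ht.symm
  refine ⟨t, ht0, ?_⟩
  rw [valuation_eq_exp_neg_ord hU p hp ht0, WithZero.exp_inj] at ht
  linarith

section Valuation

variable {U : C.X.Opens} (hU : IsAffineOpen U) [Nonempty U] [IsDedekindDomain Γ(C.X, U)]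
  [IsFractionRing Γ(C.X, U) C.X.functionField] (q : ComplexPoint C.str) (hq : q.pt ∈ U)

theorem valuation_constFF {c : ℂ} (hc : c ≠ 0) :
    (primeAt hU q hq).valuation C.X.functionField (C.constFF c) = 1 := by
  have h (c : ℂ) : (primeAt hU q hq).valuation C.X.functionField (C.constFF c) ≤ 1 := by
    rw [← C.germToFunctionField_const U]
    exact (primeAt hU q hq).valuation_le_one _
  refine le_antisymm (h c) ?_
  have h1 := h c⁻¹
  rw [map_inv₀, map_inv₀] at h1
  exact (inv_le_one₀ (zero_lt_iff.2 ((Valuation.ne_zero_iff _).2 (by simpa using hc)))).1 h1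

/-- Every function which is regular at `q` has a value in `ℂ` there. -/
theorem exists_valuation_sub_constFF_lt_one {h : C.X.functionField}
    (hh : (primeAt hU q hq).valuation C.X.functionField h ≤ 1) :
    ∃ c : ℂ, (primeAt hU q hq).valuation C.X.functionField (h - C.constFF c) < 1 := by
  set v := (primeAt hU q hq).valuation C.X.functionField with hv
  obtain ⟨a, ha⟩ := (primeAt hU q hq).exists_valuation_sub_lt_of_integer hh 1
  obtain ⟨c, hc⟩ := exists_sub_const_mem hU (primeAt hU q hq).asIdeal a
  refine ⟨c, ?_⟩
  have hc' : v (C.X.germToFunctionField U (a - C.const U c)) < 1 :=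
    ((primeAt hU q hq).valuation_lt_one_iff_mem _).2 hc
  rw [map_sub] at hc'
  rw [← C.germToFunctionField_const U]
  refine (Valuation.map_sub_swap v _ _).trans_lt ?_
  rw [← sub_add_sub_cancel _ (C.X.germToFunctionField U a)]
  exact Valuation.map_add_lt _ ((Valuation.map_sub_swap v _ _).trans_lt hc') ha

end Valuation

end SmoothCurve

namespace Covering

open SmoothCurve IsDedekindDomain

variable {C C₀ : SmoothCurve} (α : Covering C C₀)

/-- All that is needed of a locally cyclic covering is that some fibre consists of one point.
That the degree equals the multiplicity of this point follows from `sum_ramIdx_fiber`. -/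
theorem exists_fiber_eq_singleton {r : ℕ} (hα : α.IsLocallyCyclic r) :
    ∃ p q, α.fiber p = {q} := by
  obtain ⟨-, p, q, h⟩ := hα
  refine ⟨p, q, ?_⟩
  have hsub : ∀ q' ∈ α.fiber p, q' = q := by
    classical
    intro q' hq'
    have h1 := congrArg (· q') h
    simp only [pullbackDiv_apply, α.mem_fiber.1 hq', Finsupp.single_eq_same, mul_one] at h1
    by_contra hne
    rw [Finsupp.single_eq_of_ne hne] at h1
    exact (α.ramIdx_pos q').ne' (by exact_mod_cast h1)
  obtain ⟨q', hq'⟩ := α.onPoints_surjective p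
  have hq'' := α.mem_fiber.2 hq'
  exact Finset.eq_singleton_iff_unique_mem.2 ⟨hsub q' hq'' ▸ hq'', hsub⟩

/-- If the divisor of `h` is the pull-back of a divisor `D`, then `h ^ n` and `α^* N_α(h)` both have
divisor `n · α^* D` for the degree `n` of `α`, hence differ by a constant factor. -/
theorem pow_mem_range_pullbackFun {h : C.X.functionField} (hh : h ≠ 0) {D : C₀.Div}
    (hD : divFun h hh = α.pullbackDiv D) : h ^ α.fieldDegree ∈ Set.range α.pullbackFun := by
  have hN := α.normFun_ne_zero hh
  have hN' : α.pullbackFun (α.normFun h) ≠ 0 := (map_ne_zero _).2 hN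
  have hpow := pow_ne_zero α.fieldDegree hh
  obtain ⟨c, hc⟩ := exists_constFF_eq (f := h ^ α.fieldDegree * (α.pullbackFun (α.normFun h))⁻¹)
    (mul_ne_zero hpow (inv_ne_zero hN')) (fun q ↦ by
      rw [Scheme.ord_mul hpow (inv_ne_zero hN'), ord_inv hN', ord_pow hh, ord_pullbackFun α hN,
        ← normDiv_divFun α hh, hD, normDiv_pullbackDiv, ← divFun_apply hh, hD, pullbackDiv_apply,
        Finsupp.smul_apply, nsmul_eq_mul]
      exact (by ring : (0 : ℤ) = _).le)
  refine ⟨C₀.constFF c * α.normFun h, ?_⟩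
  rw [map_mul, pullbackFun_constFF, hc, inv_mul_cancel_right₀ hN']

/-- If `α^* D = div f` and `q` does not occur in `D`, then `f`, divided by its value at `q`, is
congruent to `1` at the totally ramified point `q`, so that `mem_range_of_pow_mem_range` applies. -/
theorem mem_principal_of_pullbackDiv_eq {p : ComplexPoint C₀.str} {q : ComplexPoint C.str}
    (hpq : α.fiber p = {q}) {D : C₀.Div} (hDp : D p = 0) (hD : α.pullbackDiv D ∈ C.principal) :
    D ∈ C₀.principal := by
  obtain ⟨f, hf, hfD⟩ := hD
  have hqp : α.onPoints q = p := α.mem_fiber.1 (by simp [hpq])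
  obtain ⟨U, hU, hp⟩ := exists_affine_nhd p.pt
  have hq : q.pt ∈ α.hom ⁻¹ᵁ U := by
    change (α.onPoints q).pt ∈ U
    rwa [hqp]
  have : Nonempty U := ⟨⟨_, hp⟩⟩
  have := α.nonempty_preimage U
  have hV := hU.preimage α.hom
  let := α.functionFieldAlgebra
  let := C.constFF.toAlgebra
  have := functionField_isFractionRing_of_isAffineOpen C₀.X U hU
  have := functionField_isFractionRing_of_isAffineOpen C.X _ hV
  have := α.finiteDimensional_functionField
  have := isDedekindDomain_sections hU
  have := isDedekindDomain_sections hV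
  have : CharZero C₀.X.functionField := charZero_functionField
  let v := (primeAt hU p hp).valuation C₀.X.functionField
  let w := (primeAt hV q hq).valuation C.X.functionField
  have hwf : w f = 1 := by
    rw [valuation_eq_exp_neg_ord hV q hq hf, ← hfD, pullbackDiv_apply, hqp, hDp, mul_zero, neg_zero,
      WithZero.exp_zero]
  obtain ⟨c, hc⟩ := exists_valuation_sub_constFF_lt_one hV q hq (h := f) hwf.le
  have hc0 : c ≠ 0 := by
    rintro rfl
    rw [map_zero, sub_zero] at hc
    exact hc.ne hwf
  have hc1 : C.constFF c ≠ 0 := (map_ne_zero _).2 hc0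
  have hrange : (C.constFF c)⁻¹ * f ∈
      Set.range (algebraMap C₀.X.functionField C.X.functionField) := by
    refine mem_range_of_pow_mem_range ℂ v w (fun x ↦ ?_) (fun c hc ↦ valuation_constFF hV q hq hc)
      ?_ α.fieldDegree_pos.ne' ?_
    · by_cases hx : x = 0
      · simp [hx]
      · change v (α.normFun x) = _
        rw [valuation_eq_exp_neg_ord hU p hp (α.normFun_ne_zero hx),
          valuation_eq_exp_neg_ord hV q hq hx, ord_normFun α hx, hpq, Finset.sum_singleton]
    · rw [show 1 - (C.constFF c)⁻¹ * f = -((C.constFF c)⁻¹ * (f - C.constFF c)) by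
        rw [mul_sub, inv_mul_cancel₀ hc1, neg_sub], Valuation.map_neg, map_mul, ← map_inv₀,
        valuation_constFF hV q hq (inv_ne_zero hc0), one_mul]
      exact hc
    · obtain ⟨a, ha⟩ := α.pow_mem_range_pullbackFun hf (D := D) (Finsupp.ext fun q ↦ (hfD q).symm)
      refine ⟨C₀.constFF (c⁻¹ ^ α.fieldDegree) * a, ?_⟩
      change α.pullbackFun _ = _
      rw [map_mul, ha, pullbackFun_constFF, map_pow, map_inv₀, mul_pow]
  obtain ⟨a, ha⟩ := hrange
  have hfa : α.pullbackFun (C₀.constFF c * a) = f := by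
    rw [map_mul, pullbackFun_constFF, show α.pullbackFun a = _ from ha, mul_inv_cancel_left₀ hc1]
  have ha0 : C₀.constFF c * a ≠ 0 := by
    rintro h
    rw [h, map_zero] at hfa
    exact hf hfa.symm
  refine ⟨_, ha0, fun p' ↦ ?_⟩
  obtain ⟨q', rfl⟩ := α.onPoints_surjective p'
  have h1 := hfD q'
  rw [← hfa, ord_pullbackFun α ha0, pullbackDiv_apply] at h1
  exact mul_left_cancel₀ (by exact_mod_cast (α.ramIdx_pos q').ne') h1

theorem pullbackJac_injective {p : ComplexPoint C₀.str} {q : ComplexPoint C.str}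
    (hpq : α.fiber p = {q}) : Function.Injective α.pullbackJac := by
  rw [injective_iff_map_eq_zero]
  intro x hx
  obtain ⟨D, hD, rfl⟩ := exists_toJac_eq x
  rw [pullbackJac_toJac_eq_zero_iff] at hx
  rw [toJac_eq_zero_iff]
  obtain ⟨t, ht, ht1⟩ := exists_ord_eq_one p
  -- subtract a principal divisor to achieve that the coefficient at `p` vanishes
  have hE : D p • divFun t ht ∈ C₀.principal := AddSubgroup.zsmul_mem _ (divFun_mem_principal ht) _
  rw [← sub_add_cancel D (D p • divFun t ht)]
  refine add_mem (α.mem_principal_of_pullbackDiv_eq hpq ?_ ?_) hE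
  · rw [Finsupp.sub_apply, Finsupp.smul_apply, divFun_apply, ht1, smul_eq_mul, mul_one, sub_self]
  · change α.pullbackDivHom _ ∈ _
    rw [map_sub]
    exact sub_mem hx (α.pullbackDiv_mem_principal hE)

end Covering

/-! ### Connectedness of the kernel of the norm -/

namespace ComplexPoint

variable {T : Scheme.{0}} {s : T ⟶ Spec (.of ℂ)} [LocallyOfFiniteType s]

/-- The complex points of an irreducible closed subset form an irreducible, hence connected
space. -/
theorem isPreconnected_preimage {Z : Set T} (hZ : IsClosed Z) (hZ' : IsPreirreducible Z) :
    IsPreconnected (pt ⁻¹' Z : Set (ComplexPoint s)) := by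
  have : JacobsonSpace T := LocallyOfFiniteType.jacobsonSpace s
  refine IsPreirreducible.isPreconnected ?_
  rintro _ _ ⟨U, hU, rfl⟩ ⟨V, hV, rfl⟩ ⟨x, hxZ, hxU⟩ ⟨y, hyZ, hyV⟩
  obtain ⟨z, hz, hz'⟩ := nonempty_inter_closedPoints (hZ' U V hU hV ⟨_, hxZ, hxU⟩ ⟨_, hyZ, hyV⟩)
    (hZ.isLocallyClosed.inter (hU.inter hV).isLocallyClosed)
  obtain ⟨w, rfl⟩ := SmoothCurve.exists_pt_eq (s := s) hz'
  exact ⟨w, hz⟩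

end ComplexPoint

namespace SmoothCurve

variable {C : SmoothCurve}

theorem JacFamily.continuous_classify (F : C.JacFamily) : Continuous F.classify :=
  continuous_iff_coinduced_le.2 (le_iSup (fun F : C.JacFamily ↦
    TopologicalSpace.coinduced F.classify inferInstance) F)

theorem toJac_congr {D E : C.Div} (h : D = E) (hD : C.deg D = 0) (hE : C.deg E = 0) :
    C.toJac D hD = C.toJac E hE := by
  subst h
  rfl

theorem diffDiv_cons {d : ℕ} (a b : ComplexPoint C.str) (x y : Fin d → ComplexPoint C.str) :
    C.diffDiv (Fin.cons a x : Fin (d + 1) → ComplexPoint C.str) (Fin.cons b y) =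
      (Finsupp.single a 1 - Finsupp.single b 1) + C.diffDiv x y := by
  simp only [diffDiv, Fin.sum_univ_succ, Fin.cons_zero, Fin.cons_succ]

end SmoothCurve

namespace Covering

open SmoothCurve Limits

variable {C C₀ : SmoothCurve} (α : Covering C C₀)

/-- The covering is flat, because a torsion-free module over a Dedekind domain is flat. -/
instance flat_hom : Flat α.hom where
  flat_appLE {U} hU {V} hV e := by
    by_cases hne : Nonempty V
    · have hne' : Nonempty (α.hom ⁻¹ᵁ U) := hne.map fun x ↦ ⟨x.1, e x.2⟩
      have : Nonempty U := hne.map fun x ↦ ⟨α.hom x.1, e x.2⟩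
      have := isDedekindDomain_sections hU
      let := α.sectionsAlgebra U
      have := α.isTorsionFree_sections hU
      have h1 : (α.hom.app U).hom.Flat :=
        (inferInstance : Module.Flat Γ(C₀.X, U) Γ(C.X, α.hom ⁻¹ᵁ U))
      have e' : V ≤ 𝟙 C.X ⁻¹ᵁ α.hom ⁻¹ᵁ U := e
      have h2 := Scheme.Hom.flat_appLE (𝟙 C.X) (hU.preimage α.hom) hV e'
      have h3 : α.hom.appLE U V e = α.hom.app U ≫ (𝟙 C.X : C.X ⟶ C.X).appLE _ V e' := by
        rw [Scheme.Hom.app_eq_appLE, Scheme.Hom.appLE_comp_appLE]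
        simp only [Category.id_comp]
      rw [h3]
      exact h1.comp h2
    · have : IsEmpty V := not_nonempty_iff.1 hne
      have hbot : V = ⊥ := by
        ext x
        simpa using fun hx ↦ this.elim ⟨x, hx⟩
      subst hbot
      let := (α.hom.appLE U ⊥ e).hom.toAlgebra
      exact (inferInstance : Module.Flat Γ(C₀.X, U) Γ(C.X, ⊥))

/-- The complex point of `C ×_{C₀} C` given by two points of `C` with the same image in `C₀`. -/
def pairPoint {a b : ComplexPoint C.str} (h : α.onPoints a = α.onPoints b) :
    ComplexPoint (pullback.fst α.hom α.hom ≫ C.str) :=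
  ⟨pullback.lift a.1 b.1 (congrArg Subtype.val h),
    (pullback.lift_fst_assoc _ _ _ _).trans a.2⟩

theorem snd_str : pullback.snd α.hom α.hom ≫ C.str = pullback.fst α.hom α.hom ≫ C.str := by
  rw [← α.hom_str, pullback.condition_assoc]

theorem map_fst_pairPoint {a b : ComplexPoint C.str} (h : α.onPoints a = α.onPoints b) :
    (α.pairPoint h).map (pullback.fst α.hom α.hom) rfl = a :=
  Subtype.ext (pullback.lift_fst _ _ _)

theorem map_snd_pairPoint {a b : ComplexPoint C.str} (h : α.onPoints a = α.onPoints b) :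
    (α.pairPoint h).map (pullback.snd α.hom α.hom) α.snd_str = b :=
  Subtype.ext (pullback.lift_snd _ _ _)

theorem onPoints_map_fst_eq (t : ComplexPoint (pullback.fst α.hom α.hom ≫ C.str)) :
    α.onPoints (t.map (pullback.fst α.hom α.hom) rfl) =
      α.onPoints (t.map (pullback.snd α.hom α.hom) α.snd_str) := by
  apply Subtype.ext
  change (t.1 ≫ _) ≫ α.hom = (t.1 ≫ _) ≫ α.hom
  rw [Category.assoc, Category.assoc, pullback.condition]

/-- If the fibre of `α` over some point consists of `q` only, then every point `(a, b)` of
`C ×_{C₀} C` lies on an irreducible closed subset through `(q, q)`: by flatness `(a, b)` is a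
specialization of a point over the generic point of `C`, and the closure of the latter maps onto
`C`. -/
theorem exists_irreducible {p : ComplexPoint C₀.str} {q : ComplexPoint C.str}
    (hpq : α.fiber p = {q}) {a b : ComplexPoint C.str} (h : α.onPoints a = α.onPoints b) :
    ∃ Z : Set ↥(pullback α.hom α.hom), IsClosed Z ∧ IsPreirreducible Z ∧ (α.pairPoint h).pt ∈ Z ∧
      (α.pairPoint (rfl : α.onPoints q = α.onPoints q)).pt ∈ Z := by
  have hgen : genericPoint C.X ⤳ pullback.fst α.hom α.hom (α.pairPoint h).pt :=
    genericPoint_specializes _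
  obtain ⟨ζ, hζ, hζ'⟩ := Flat.generalizingMap (pullback.fst α.hom α.hom) hgen
  refine ⟨closure {ζ}, isClosed_closure, isIrreducible_singleton.closure.2, hζ.mem_closure, ?_⟩
  have : JacobsonSpace ↥(pullback α.hom α.hom) :=
    LocallyOfFiniteType.jacobsonSpace (pullback.fst α.hom α.hom ≫ C.str)
  have hclosed := (pullback.fst α.hom α.hom).isClosedMap _ (isClosed_closure (s := {ζ}))
  have hq : q.pt ∈ pullback.fst α.hom α.hom '' closure {ζ} := by
    refine (genericPoint_specializes q.pt).mem_closed hclosed ?_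
    exact ⟨ζ, subset_closure rfl, hζ'⟩
  obtain ⟨w, hwZ, hw⟩ := hq
  obtain ⟨z, ⟨hzZ, hz⟩, hz'⟩ := nonempty_inter_closedPoints
    (Z := closure {ζ} ∩ pullback.fst α.hom α.hom ⁻¹' {q.pt}) ⟨w, hwZ, hw⟩
    (isClosed_closure.inter ((isClosed_pt q).preimage
      (pullback.fst α.hom α.hom).continuous)).isLocallyClosed
  obtain ⟨t, rfl⟩ := exists_pt_eq (s := pullback.fst α.hom α.hom ≫ C.str) hz'
  have h1 : t.map (pullback.fst α.hom α.hom) rfl = q := ComplexPoint.pt_injective hz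
  have h2 : t.map (pullback.snd α.hom α.hom) α.snd_str = q := by
    have hqp : α.onPoints q = p := α.mem_fiber.1 (by simp [hpq])
    have h3 := α.mem_fiber.2 ((α.onPoints_map_fst_eq t).symm.trans ((congrArg _ h1).trans hqp))
    rwa [hpq, Finset.mem_singleton] at h3
  have h3 : t = α.pairPoint (rfl : α.onPoints q = α.onPoints q) := by
    apply Subtype.ext
    refine pullback.hom_ext ?_ ?_
    · exact (congrArg Subtype.val h1).trans (pullback.lift_fst _ _ _).symm
    · exact (congrArg Subtype.val h2).trans (pullback.lift_snd _ _ _).symm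
  rwa [← h3]

/-- The family of divisors `(a - b) + ∑ (x_i - y_i)` with moving `(a, b) ∈ C ×_{C₀} C` and fixed
`x_i, y_i`. -/
def pairFamily {d : ℕ} (x y : Fin d → ComplexPoint C.str) : C.JacFamily where
  T := pullback α.hom α.hom
  str := pullback.fst α.hom α.hom ≫ C.str
  locallyOfFiniteType := inferInstance
  d := d + 1
  x := Fin.cons (pullback.fst α.hom α.hom) fun i ↦
    (pullback.fst α.hom α.hom ≫ C.str) ≫ (x i).1
  y := Fin.cons (pullback.snd α.hom α.hom) fun i ↦
    (pullback.fst α.hom α.hom ≫ C.str) ≫ (y i).1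
  x_over := Fin.cases rfl fun i ↦ by
    rw [Fin.cons_succ, Category.assoc, (x i).2, Category.comp_id]
  y_over := Fin.cases α.snd_str fun i ↦ by
    rw [Fin.cons_succ, Category.assoc, (y i).2, Category.comp_id]

theorem classify_pairFamily {d : ℕ} (x y : Fin d → ComplexPoint C.str)
    (t : ComplexPoint (pullback.fst α.hom α.hom ≫ C.str)) :
    (α.pairFamily x y).classify t = C.toJac
      (C.diffDiv (Fin.cons (t.map (pullback.fst α.hom α.hom) rfl) x : Fin (d + 1) → _)
        (Fin.cons (t.map (pullback.snd α.hom α.hom) α.snd_str) y)) (C.deg_diffDiv _ _) := by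
  have key (z : ComplexPoint C.str) : t.1 ≫ (pullback.fst α.hom α.hom ≫ C.str) ≫ z.1 = z.1 := by
    rw [← Category.assoc, t.2, Category.id_comp]
  refine toJac_congr ?_ _ _
  congr 1
  · ext1 i
    induction i using Fin.cases with
    | zero => rfl
    | succ i => exact Subtype.ext (key (x i))
  · ext1 i
    induction i using Fin.cases with
    | zero => rfl
    | succ i => exact Subtype.ext (key (y i))

theorem normDiv_diffDiv {d : ℕ} {x y : Fin d → ComplexPoint C.str}
    (h : ∀ i, α.onPoints (x i) = α.onPoints (y i)) : α.normDiv (C.diffDiv x y) = 0 := by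
  rw [diffDiv, map_sum]
  refine Finset.sum_eq_zero fun i _ ↦ ?_
  change Finsupp.mapDomain _ _ = _
  rw [Finsupp.mapDomain_sub, Finsupp.mapDomain_single, Finsupp.mapDomain_single, h, sub_self]

theorem toJac_diffDiv_mem_ker {d : ℕ} {x y : Fin d → ComplexPoint C.str}
    (h : ∀ i, α.onPoints (x i) = α.onPoints (y i)) :
    C.toJac (C.diffDiv x y) (C.deg_diffDiv _ _) ∈ α.normJac.ker := by
  rw [AddMonoidHom.mem_ker, normJac_toJac_eq_zero_iff, normDiv_diffDiv α h]
  exact zero_mem _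

/-- The class of `∑ (x_i - y_i)` with `α(x_i) = α(y_i)` can be moved to `0` within the kernel of
the norm, by moving the pairs `(x_i, y_i)` to `(q, q)` one after the other. -/
theorem exists_isPreconnected {p : ComplexPoint C₀.str} {q : ComplexPoint C.str}
    (hpq : α.fiber p = {q}) {d : ℕ} {x y : Fin d → ComplexPoint C.str}
    (h : ∀ i, α.onPoints (x i) = α.onPoints (y i)) :
    ∃ S : Set C.Jac, S ⊆ α.normJac.ker ∧ 0 ∈ S ∧
      C.toJac (C.diffDiv x y) (C.deg_diffDiv _ _) ∈ S ∧ IsPreconnected S := by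
  induction d with
  | zero =>
    refine ⟨{0}, by simp, rfl, ?_, isPreconnected_singleton⟩
    rw [Set.mem_singleton_iff, toJac_eq_zero_iff]
    simp [diffDiv]
  | succ d ih =>
    obtain ⟨S, hS, h0, hxy, hpre⟩ := ih (x := Fin.tail x) (y := Fin.tail y) fun i ↦ h i.succ
    obtain ⟨Z, hZ, hZ', hab, hqq⟩ := α.exists_irreducible hpq (h 0)
    have hT := (ComplexPoint.isPreconnected_preimage (s := pullback.fst α.hom α.hom ≫ C.str)
      hZ hZ').image (α.pairFamily (Fin.tail x) (Fin.tail y)).classify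
      (JacFamily.continuous_classify _).continuousOn
    refine ⟨S ∪ (α.pairFamily (Fin.tail x) (Fin.tail y)).classify '' (ComplexPoint.pt ⁻¹' Z),
      Set.union_subset hS ?_, Or.inl h0,
      Or.inr ⟨α.pairPoint (h 0), hab, ?_⟩,
      hpre.union (C.toJac (C.diffDiv (Fin.tail x) (Fin.tail y)) (C.deg_diffDiv _ _)) hxy
        ⟨α.pairPoint (rfl : α.onPoints q = α.onPoints q), hqq, ?_⟩ hT⟩
    · rintro _ ⟨t, -, rfl⟩
      exact Eq.subst (motive := (· ∈ α.normJac.ker)) (α.classify_pairFamily _ _ t).symm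
        (α.toJac_diffDiv_mem_ker (Fin.cases (α.onPoints_map_fst_eq t) fun i ↦ h i.succ))
    · rw [classify_pairFamily]
      refine toJac_congr ?_ _ _
      rw [map_fst_pairPoint, map_snd_pairPoint]
      congr 1 <;> exact Fin.cons_self_tail _
    · rw [classify_pairFamily]
      refine toJac_congr ?_ _ _
      rw [map_fst_pairPoint, map_snd_pairPoint, diffDiv_cons, sub_self, zero_add]

/-- A divisor with vanishing norm is a sum of differences of points in the same fibre. -/
theorem exists_diffDiv_eq {D : C.Div} (hD : α.normDiv D = 0) :
    ∃ (d : ℕ) (x y : Fin d → ComplexPoint C.str),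
      (∀ i, α.onPoints (x i) = α.onPoints (y i)) ∧ C.diffDiv x y = D := by
  choose s hs using α.onPoints_surjective
  let G : Set C.Div := {D | ∃ a b, α.onPoints a = α.onPoints b ∧
    D = Finsupp.single a 1 - Finsupp.single b 1}
  have hG (D : C.Div) : D - Finsupp.mapDomain s (α.normDiv D) ∈ AddSubgroup.closure G := by
    induction D using Finsupp.induction_linear with
    | zero => simp
    | add D E hD hE =>
      rw [map_add, Finsupp.mapDomain_add, add_sub_add_comm]
      exact add_mem hD hE
    | single q n =>
      have : (Finsupp.single q n - Finsupp.mapDomain s (α.normDiv (Finsupp.single q n)) : C.Div) =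
          n • (Finsupp.single q 1 - Finsupp.single (s (α.onPoints q)) 1) := by
        change Finsupp.single q n - Finsupp.mapDomain s (Finsupp.mapDomain _ _) = _
        rw [Finsupp.mapDomain_single, Finsupp.mapDomain_single, smul_sub]
        simp
      rw [this]
      exact AddSubgroup.zsmul_mem _
        (AddSubgroup.subset_closure (show _ ∈ G from ⟨q, _, (hs _).symm, rfl⟩)) n
  have h := hG D
  rw [hD, Finsupp.mapDomain_zero, sub_zero] at h
  clear hD
  have hcons : ∀ a b, α.onPoints a = α.onPoints b → ∀ D : C.Div,
      (∃ (d : ℕ) (x y : Fin d → ComplexPoint C.str),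
        (∀ i, α.onPoints (x i) = α.onPoints (y i)) ∧ C.diffDiv x y = D) →
      ∃ (d : ℕ) (x y : Fin d → ComplexPoint C.str),
        (∀ i, α.onPoints (x i) = α.onPoints (y i)) ∧
          C.diffDiv x y = (Finsupp.single a 1 - Finsupp.single b 1) + D := by
    rintro a b hab _ ⟨d, x, y, hxy, rfl⟩
    exact ⟨d + 1, Fin.cons a x, Fin.cons b y, Fin.cases hab hxy, diffDiv_cons a b x y⟩
  induction h using AddSubgroup.closure_induction_left with
  | zero => exact ⟨0, Fin.elim0, Fin.elim0, fun i ↦ i.elim0, by simp [diffDiv]⟩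
  | add_left x hx y hy ih =>
    obtain ⟨a, b, hab, rfl⟩ := hx
    exact hcons a b hab _ ih
  | neg_add_cancel x hx y hy ih =>
    obtain ⟨a, b, hab, rfl⟩ := hx
    rw [neg_sub]
    exact hcons b a hab.symm _ ih

/-- By Tsen's theorem, every class in the kernel of the norm is that of a divisor with norm `0`. -/
theorem exists_normDiv_eq_zero {x : C.Jac} (hx : x ∈ α.normJac.ker) :
    ∃ (D : C.Div) (hD : C.deg D = 0), α.normDiv D = 0 ∧ C.toJac D hD = x := by
  obtain ⟨D, hD, rfl⟩ := exists_toJac_eq x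
  rw [AddMonoidHom.mem_ker, normJac_toJac_eq_zero_iff] at hx
  obtain ⟨g, hg, hDg⟩ := hx
  obtain ⟨f, rfl⟩ := α.normFun_surjective g
  have hf : f ≠ 0 := by
    rintro rfl
    let := α.functionFieldAlgebra
    have := α.finiteDimensional_functionField
    exact hg Algebra.norm_zero
  have h0 : α.normDiv (D - divFun f hf) = 0 := by
    ext p
    rw [map_sub, Finsupp.sub_apply, hDg, normDiv_divFun, sub_self, Finsupp.zero_apply]
  refine ⟨D - divFun f hf, by rw [← deg_normDiv α, h0, map_zero], h0, ?_⟩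
  rw [toJac_eq_iff, sub_sub_cancel_left]
  exact neg_mem (divFun_mem_principal hf)

theorem isConnected_ker_normJac {p : ComplexPoint C₀.str} {q : ComplexPoint C.str}
    (hpq : α.fiber p = {q}) : _root_.IsConnected (α.normJac.ker : Set C.Jac) := by
  refine ⟨⟨0, zero_mem _⟩, isPreconnected_of_forall 0 fun x hx ↦ ?_⟩
  obtain ⟨D, hD, hD0, rfl⟩ := α.exists_normDiv_eq_zero hx
  obtain ⟨d, x, y, hxy, rfl⟩ := α.exists_diffDiv_eq hD0
  exact α.exists_isPreconnected hpq hxy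

end Covering

end

/-- For a locally cyclic covering `α : C ⟶ C₀` of degree `r`, the pull-back homomorphism
`α^* : Jac(C₀) → Jac(C)` is injective, and the Prym variety `Prym(α)`, the kernel of the norm
homomorphism `N_α : Jac(C) → Jac(C₀)`, is connected. -/
theorem proposition1p7 (C C₀ : SmoothCurve) (α : Covering C C₀) (r : ℕ)
    (hα : α.IsLocallyCyclic r) :
    (∃ φ : C₀.Jac →+ C.Jac, α.IsPullbackHom φ ∧ Function.Injective φ) ∧
    (∃ N : C.Jac →+ C₀.Jac, α.IsNormHom N ∧ _root_.IsConnected (N.ker : Set C.Jac)) := by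
  obtain ⟨p, q, hpq⟩ := α.exists_fiber_eq_singleton hα
  exact ⟨⟨α.pullbackJac, α.isPullbackHom_pullbackJac, α.pullbackJac_injective hpq⟩,
    ⟨α.normJac, α.isNormHom_normJac, α.isConnected_ker_normJac hpq⟩⟩
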